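/- Let $d\ge 1$, $m\ge 2$, let $\alpha_1,\dots,\alpha_m,\beta\in\{0,1,2,\dots\}^d$ be multi-indices, and suppose that there are vectors $\Lambda,\Gamma\in\{1,2,3,\dots\}^d$ such that \[ \langle\alpha_1,\Lambda\rangle=\langle\alpha_2,\Lambda\rangle=\dots=\langle\alpha_m,\Lambda\rangle=\langle\beta,\Lambda\rangle \quad\text{and}\quad \langle\alpha_1,\Gamma\rangle>\langle\beta,\Gamma\rangle>\langle\alpha_2,\Gamma\rangle\ge\dots\ge\langle\alpha_m,\Gamma\rangle . \] For $N\in\{1,2,3,\dots\}$ let $K_N\in[0,\infty]$ be the smallest constant such that \[ \|D^{\beta}f\|_{L_1(\mathbb T^d)}\le K_N\sum_{j=1}^m\|D^{\alpha_j}f\|_{L_1(\mathbb T^d)} \] for every trigonometric polynomial $f$ on $\mathbb T^d=(\mathbb R/2\pi\mathbb Z)^d$ of degree at most $N$, that is, for every $f(x)=\sum_{q\in\mathbb Z^d,\ \max_i|q_i|\le N}c_q e^{i\langle q,x\rangle}$ with $c_q\in\mathbb C$ (where $K_N=\infty$ if no finite constant works, and $L_1(\mathbb T^d)$ is taken with respect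 to the normalized Haar measure). Then there is a constant $C>0$, independent of $N$, such that for all $N\ge 1$ \[ K_N>C(\ln N)^{\phi},\qquad \phi=\frac12\left(1-\frac{\langle\alpha_1-\beta,\Gamma\rangle}{\langle\alpha_1-\alpha_2,\Gamma\rangle}\right). \] -/

import Mathlib

open scoped ENNReal NNReal

noncomputable section

/-- The character `x ↦ exp (i ⟨q, x⟩)` with frequency `q ∈ ℤ^d`. Functions on the torus `𝕋^d` are
regarded as functions on `ℝ^d` that are `2π`-periodic in every variable. -/
def torusChar {d : ℕ} (q : Fin d → ℤ) (x : Fin d → ℝ) : ℂ :=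
  Complex.exp (Complex.I * ((∑ i, (q i : ℝ) * x i : ℝ) : ℂ))

/-- `f` is a (complex) trigonometric polynomial on `𝕋^d` of degree at most `N`: a linear combination
of characters whose frequencies satisfy `|q i| ≤ N` for all `i`. -/
def IsTrigPolyLE {d : ℕ} (N : ℕ) (f : (Fin d → ℝ) → ℂ) : Prop :=
  ∃ c : (Fin d → ℤ) → ℂ, ∀ x,
    f x = ∑ q ∈ Fintype.piFinset (fun _ : Fin d => Finset.Icc (-(N : ℤ)) (N : ℤ)),
      c q * torusChar q x

/-- The partial derivative `∂f/∂x_i`. -/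
def partialDeriv {d : ℕ} (i : Fin d) (f : (Fin d → ℝ) → ℂ) : (Fin d → ℝ) → ℂ :=
  fun x => lineDeriv ℝ f x (Pi.single i 1)

/-- The mixed derivative `D^μ f = ∂_1^{μ_1} ⋯ ∂_d^{μ_d} f` for a multi-index `μ`. -/
def multiDeriv {d : ℕ} (μ : Fin d → ℕ) (f : (Fin d → ℝ) → ℂ) : (Fin d → ℝ) → ℂ :=
  (List.finRange d).foldr (fun i g => (partialDeriv i)^[μ i] g) f

/-- The norm of `L_1(𝕋^d)` with respect to the normalized Haar measure: the mean value of `‖g‖`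
over the period cell `[0, 2π]^d`. -/
def torusL1Norm {d : ℕ} (g : (Fin d → ℝ) → ℂ) : ℝ :=
  ⨍ x in Set.Icc (0 : Fin d → ℝ) (fun _ => 2 * Real.pi), ‖g x‖

/-- The best constant `K_N` in `‖D^β f‖₁ ≤ K_N ∑_{j=1}^m ‖D^{α_j} f‖₁` over trigonometric
polynomials of degree at most `N`; it is `∞` if there is no finite constant. -/
def bestConst {d : ℕ} (m : ℕ) (α : ℕ → Fin d → ℕ) (β : Fin d → ℕ) (N : ℕ) : ℝ≥0∞ :=
  ⨅ (K : ℝ≥0) (_ : ∀ f : (Fin d → ℝ) → ℂ, IsTrigPolyLE N f →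
      torusL1Norm (multiDeriv β f) ≤
        K * ∑ j ∈ Finset.Icc 1 m, torusL1Norm (multiDeriv (α j) f)), (K : ℝ≥0∞)

end

/-!
For frequencies `a k` growing fast enough, the Riesz product `R k` of Fejér kernels in the variables
`⟨a j, x⟩`, `j < k`, is nonnegative with mean `1`, so its `L₁` norm is `1`. The extremal polynomial
is an approximate `D^{α₁}`-primitive of `R (2 b) - 1`; hence its `D^{α₁}` has bounded norm. It is a
sum of blocks, the block `k` having its frequencies near multiples of `a k`, and there every other
derivative `D^γ` differs from `D^{α₁}` by the factor `(a k)^γ / (a k)^{α₁}`.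

Take `a k = s ^ (E k Λ + e_k Γ)`. Since all derivatives have the same `Λ`-order, this factor is
`s ^ (e_k ⟨γ - α₁, Γ⟩)`. With `e_k = 1` for even `k`, `e_k` large for odd `k`, and `b = s ^ p`,
`p = ⟨α₁ - α₂, Γ⟩`, the odd blocks are negligible and the `b` even blocks have total norm at most a
constant for `D^{α_j}`, `j ≥ 2`. For `D^β` the same factor is `s ^ (r - p)`, `r = ⟨β - α₂, Γ⟩`, and
the norm is of order `s ^ r` because the even blocks do not cancel: the characters
`e^{-i⟨a (2j), x⟩}` that detect them are multiplied by
`sin² (⟨a (2j+1), x⟩ / 2) ∏_{i < j} cos² (⟨a (2i+1), x⟩ / 2)`, and these weights have sum at most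
`1`, whereas the odd Fejér kernels, of order `b`, are so concentrated that each `cos²` costs only a
factor `1 - 1 / (2 b)`.

All frequencies are at most `s ^ (C s ^ p)`, so `ln N` is of order `s ^ p ln s`, and `s ^ r` exceeds
`(ln N) ^ φ` for every `φ < r / p`.
-/

theorem multiIndex_induction {ι : Type*} [Finite ι] [DecidableEq ι] {P : (ι → ℕ) → Prop}
    (zero : P 0) (add_single : ∀ γ i, P γ → P (γ + Pi.single i 1)) (γ : ι → ℕ) : P γ := by
  have key : ∀ s : Multiset ι, P fun i => s.count i := fun s => by
    induction s using Multiset.induction with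
    | empty => exact zero
    | cons i s ih =>
      convert add_single _ i ih using 1
      ext j
      simp [Multiset.count_cons, Pi.single_apply]
  cases nonempty_fintype ι
  convert key (∑ i, γ i • {i}) with i
  simp [Multiset.count_sum', Multiset.count_singleton]

/-- The monomial `x^γ = ∏ i, x i ^ γ i` of a multi-index `γ`. -/
def multiPow {ι R : Type*} [Fintype ι] [CommMonoid R] (x : ι → R) (γ : ι → ℕ) : R :=
  ∏ i, x i ^ γ i

section MultiPow

variable {ι : Type*} [Fintype ι]

theorem multiPow_zero {R : Type*} [CommMonoid R] (x : ι → R) : multiPow x 0 = 1 := by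
  simp [multiPow]

theorem multiPow_add_single {R : Type*} [CommMonoid R] [DecidableEq ι] (x : ι → R) (γ : ι → ℕ)
    (i : ι) : multiPow x (γ + Pi.single i 1) = x i * multiPow x γ := by
  simp only [multiPow, Pi.add_apply, pow_add, Finset.prod_mul_distrib]
  rw [mul_comm, Finset.prod_eq_single i (fun j _ hj => by simp [hj]) (by simp)]
  simp

theorem multiPow_single {R : Type*} [CommMonoid R] [DecidableEq ι] (x : ι → R) (i : ι) :
    multiPow x (Pi.single i 1) = x i := by
  simpa [multiPow_zero] using multiPow_add_single x 0 i

theorem multiPow_smul (c : ℝ) (x : ι → ℝ) (γ : ι → ℕ) :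
    multiPow (c • x) γ = c ^ (∑ i, γ i) * multiPow x γ := by
  simp [multiPow, mul_pow, Finset.prod_mul_distrib, Finset.prod_pow_eq_pow_sum]

theorem multiPow_nonneg {x : ι → ℝ} (hx : 0 ≤ x) (γ : ι → ℕ) : 0 ≤ multiPow x γ :=
  Finset.prod_nonneg fun i _ => pow_nonneg (hx i) _

theorem multiPow_pos {x : ι → ℝ} (hx : ∀ i, 0 < x i) (γ : ι → ℕ) : 0 < multiPow x γ :=
  Finset.prod_pos fun i _ => pow_pos (hx i) _

theorem multiPow_le_multiPow {x y : ι → ℝ} (hx : 0 ≤ x) (hxy : x ≤ y) (γ : ι → ℕ) :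
    multiPow x γ ≤ multiPow y γ :=
  Finset.prod_le_prod (fun i _ => pow_nonneg (hx i) _)
    fun i _ => pow_le_pow_left₀ (hx i) (hxy i) _

theorem mul_multiPow_le_multiPow_smul {x : ι → ℝ} (hx : 0 ≤ x) {c : ℝ} (hc : 1 ≤ c) {γ : ι → ℕ}
    (hγ : γ ≠ 0) : c * multiPow x γ ≤ multiPow (c • x) γ := by
  rw [multiPow_smul]
  refine mul_le_mul_of_nonneg_right (le_self_pow₀ hc fun h => hγ ?_) (multiPow_nonneg hx γ)
  exact funext fun i => Finset.sum_eq_zero_iff.1 h i (Finset.mem_univ i)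

theorem one_add_pow_le_of_le_one {δ : ℝ} (h₀ : 0 ≤ δ) (h₁ : δ ≤ 1) (n : ℕ) :
    (1 + δ) ^ n ≤ 1 + (2 ^ n - 1) * δ := by
  induction n with
  | zero => simp
  | succ n ih =>
    have hsq : (2 ^ n - 1) * (δ * δ) ≤ (2 ^ n - 1) * (δ * 1) := by
      gcongr
      exact sub_nonneg.2 (one_le_pow₀ one_le_two)
    rw [pow_succ, pow_succ]
    nlinarith

theorem multiPow_add_sub_multiPow_le {x A : ι → ℝ} {δ : ℝ} (hx : 0 ≤ x) (hA : 0 ≤ A)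
    (h₀ : 0 ≤ δ) (h₁ : δ ≤ 1) (hxA : A ≤ δ • x) (γ : ι → ℕ) {n : ℕ} (hn : ∑ i, γ i ≤ n) :
    multiPow (x + A) γ - multiPow x γ ≤ 2 ^ n * δ * multiPow x γ := by
  have hpow : (1 + δ) ^ (∑ i, γ i) ≤ 1 + 2 ^ n * δ := by
    refine (pow_le_pow_right₀ (by linarith) hn).trans ((one_add_pow_le_of_le_one h₀ h₁ n).trans ?_)
    linarith
  have : multiPow (x + A) γ ≤ (1 + 2 ^ n * δ) * multiPow x γ := by
    calc multiPow (x + A) γ ≤ multiPow ((1 + δ) • x) γ :=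
          multiPow_le_multiPow (add_nonneg hx hA) (by rw [add_smul, one_smul]; gcongr) γ
      _ ≤ _ := by
          rw [multiPow_smul]
          exact mul_le_mul_of_nonneg_right hpow (multiPow_nonneg hx γ)
  linarith

end MultiPow

/-- Trigonometric polynomials on `𝕋^d`, encoded by their finitely supported families of Fourier
coefficients, so that the product is the convolution product of `ℤ^d`. -/
abbrev TrigPoly (d : ℕ) : Type := AddMonoidAlgebra ℂ (Fin d → ℤ)

namespace TrigPoly

noncomputable section

variable {d : ℕ}

/-! ### Evaluation -/

theorem torusChar_zero (x : Fin d → ℝ) : torusChar 0 x = 1 := by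
  simp [torusChar]

theorem torusChar_add (q r : Fin d → ℤ) (x : Fin d → ℝ) :
    torusChar (q + r) x = torusChar q x * torusChar r x := by
  simp [torusChar, ← Complex.exp_add, ← mul_add, ← Finset.sum_add_distrib, add_mul]

theorem norm_torusChar (q : Fin d → ℤ) (x : Fin d → ℝ) : ‖torusChar q x‖ = 1 := by
  rw [torusChar, mul_comm, Complex.norm_exp_ofReal_mul_I]

theorem torusChar_neg (q : Fin d → ℤ) (x : Fin d → ℝ) :
    torusChar (-q) x = (starRingEnd ℂ) (torusChar q x) := by
  simp [torusChar, ← Complex.exp_conj]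

@[fun_prop]
theorem continuous_torusChar (q : Fin d → ℤ) : Continuous (torusChar q) := by
  unfold torusChar
  fun_prop

/-- Evaluation of a trigonometric polynomial as a function of `x ∈ ℝ^d`. -/
def eval : TrigPoly d →ₐ[ℂ] ((Fin d → ℝ) → ℂ) :=
  AddMonoidAlgebra.lift ℂ _ _
    { toFun := fun q => torusChar q.toAdd
      map_one' := funext torusChar_zero
      map_mul' := fun q r => funext fun x => torusChar_add q.toAdd r.toAdd x }

/-- The character `x ↦ exp (i ⟨q, x⟩)` as a trigonometric polynomial. -/
def character (q : Fin d → ℤ) : TrigPoly d := AddMonoidAlgebra.single q 1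

theorem coeff_character (q r : Fin d → ℤ) :
    (character q).coeff r = if q = r then 1 else 0 := by
  classical
  rw [character, AddMonoidAlgebra.coeff_single, Finsupp.single_apply]

theorem character_zero : character (0 : Fin d → ℤ) = 1 := rfl

theorem character_mul (q r : Fin d → ℤ) : character q * character r = character (q + r) := by
  simp [character, AddMonoidAlgebra.single_mul_single]

theorem character_pow (q : Fin d → ℤ) (n : ℕ) : character q ^ n = character (n • q) := by
  simp [character, AddMonoidAlgebra.single_pow]

theorem single_eq_smul_character (q : Fin d → ℤ) (c : ℂ) :
    AddMonoidAlgebra.single q c = c • character q := by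
  simp [character]

theorem induction_character {P : TrigPoly d → Prop} (f : TrigPoly d) (zero : P 0)
    (add : ∀ f g, P f → P g → P (f + g)) (smul : ∀ (c : ℂ) q, P (c • character q)) : P f :=
  AddMonoidAlgebra.induction_linear f zero add fun q c => single_eq_smul_character q c ▸ smul c q

theorem eval_character (q : Fin d → ℤ) : eval (character q) = torusChar q := by
  simp [eval, character]

theorem eval_apply (f : TrigPoly d) (x : Fin d → ℝ) :
    eval f x = ∑ q ∈ f.coeff.support, f.coeff q * torusChar q x := by
  simp [eval, AddMonoidAlgebra.lift_apply, Finsupp.sum]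

@[fun_prop]
theorem continuous_eval (f : TrigPoly d) : Continuous (eval f) := by
  induction f using induction_character with
  | zero => simpa using! continuous_const
  | add f g hf hg => simpa using! hf.add hg
  | smul c q => simpa [eval_character] using! (continuous_torusChar q).const_smul c

/-! ### Multipliers and derivatives -/

/-- The Fourier multiplier with symbol `σ`. -/
def multiplier (σ : (Fin d → ℤ) → ℂ) : TrigPoly d →ₗ[ℂ] TrigPoly d where
  toFun f := .ofCoeff (Finsupp.onFinset f.coeff.support (fun q => σ q * f.coeff q)
    fun _ hq => Finsupp.mem_support_iff.2 (right_ne_zero_of_mul hq))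
  map_add' f g := by ext q; simp [mul_add]
  map_smul' c f := by ext q; simp; ring

theorem coeff_multiplier (σ : (Fin d → ℤ) → ℂ) (f : TrigPoly d) (q : Fin d → ℤ) :
    (multiplier σ f).coeff q = σ q * f.coeff q := rfl

theorem multiplier_multiplier (σ τ : (Fin d → ℤ) → ℂ) (f : TrigPoly d) :
    multiplier σ (multiplier τ f) = multiplier (σ * τ) f := by
  ext q; simp [coeff_multiplier, mul_assoc]

theorem multiplier_one (f : TrigPoly d) : multiplier 1 f = f := by
  ext q; simp [coeff_multiplier]

theorem multiplier_character (σ : (Fin d → ℤ) → ℂ) (q : Fin d → ℤ) :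
    multiplier σ (character q) = σ q • character q := by
  ext r
  rw [coeff_multiplier, AddMonoidAlgebra.coeff_smul, Finsupp.smul_apply, coeff_character,
    smul_eq_mul]
  split_ifs with h
  · rw [h]
  · simp

theorem hasLineDerivAt_torusChar (q : Fin d → ℤ) (i : Fin d) (x : Fin d → ℝ) :
    HasLineDerivAt ℝ (torusChar q) (Complex.I * q i * torusChar q x) x (Pi.single i 1) := by
  have hline : (fun t : ℝ => torusChar q (x + t • Pi.single i 1)) =
      fun t : ℝ => torusChar q x * Complex.exp (Complex.I * q i * (t : ℂ)) := by
    funext t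
    have : ∑ j, (q j : ℝ) * (x j + t * (Pi.single i (1 : ℝ) : Fin d → ℝ) j) =
        (∑ j, (q j : ℝ) * x j) + q i * t := by
      simp [mul_add, Finset.sum_add_distrib, Pi.single_apply]
    simp only [torusChar, ← Complex.exp_add, Pi.add_apply, Pi.smul_apply, smul_eq_mul, this]
    push_cast
    ring_nf
  have hexp : HasDerivAt (fun t : ℝ => Complex.exp (Complex.I * q i * (t : ℂ)))
      (Complex.I * q i) 0 := by
    simpa using ((HasDerivAt.ofReal_comp (hasDerivAt_id (0 : ℝ))).const_mul (Complex.I * q i)).cexp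
  rw [HasLineDerivAt, hline, mul_comm (Complex.I * _)]
  exact hexp.const_mul _

theorem hasLineDerivAt_eval (f : TrigPoly d) (i : Fin d) (x : Fin d → ℝ) :
    HasLineDerivAt ℝ (eval f) (eval (multiplier (fun q => Complex.I * q i) f) x) x
      (Pi.single i 1) := by
  induction f using induction_character with
  | zero => simpa using! hasDerivAt_const (0 : ℝ) (0 : ℂ)
  | add f g hf hg => simpa using! HasDerivAt.add hf hg
  | smul c q =>
    simpa [multiplier_character, eval_character] using!
      HasDerivAt.const_mul c (hasLineDerivAt_torusChar q i x)

theorem iterate_partialDeriv_eval (i : Fin d) (n : ℕ) (f : TrigPoly d) :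
    (partialDeriv i)^[n] (eval f) = eval (multiplier (fun q => (Complex.I * q i) ^ n) f) := by
  induction n generalizing f with
  | zero => simpa using! congrArg eval (multiplier_one f).symm
  | succ n ih =>
    have : partialDeriv i (eval f) = eval (multiplier (fun q => Complex.I * q i) f) :=
      funext fun x => (hasLineDerivAt_eval f i x).lineDeriv
    rw [Function.iterate_succ_apply, this, ih, multiplier_multiplier]
    congr 2

/-- The symbol `(iq)^γ` of `D^γ`. -/
def symbol (γ : Fin d → ℕ) (q : Fin d → ℤ) : ℂ := multiPow (fun i => Complex.I * q i) γ

theorem symbol_add_single (γ : Fin d → ℕ) (i : Fin d) (q : Fin d → ℤ) :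
    symbol (γ + Pi.single i 1) q = Complex.I * q i * symbol γ q :=
  multiPow_add_single _ γ i

/-- The mixed derivative `D^γ` on trigonometric polynomials. -/
def mixedDeriv (γ : Fin d → ℕ) : TrigPoly d →ₗ[ℂ] TrigPoly d := multiplier (symbol γ)

theorem multiDeriv_eval (γ : Fin d → ℕ) (f : TrigPoly d) :
    multiDeriv γ (eval f) = eval (mixedDeriv γ f) := by
  have key : ∀ l : List (Fin d), l.foldr (fun i g => (partialDeriv i)^[γ i] g) (eval f) =
      eval (multiplier (fun q => (l.map fun i => (Complex.I * q i) ^ γ i).prod) f) := by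
    intro l
    induction l with
    | nil => simpa using! congrArg eval (multiplier_one f).symm
    | cons i l ih =>
      rw [List.foldr_cons, ih, iterate_partialDeriv_eval, multiplier_multiplier]
      congr 2
  rw [multiDeriv, key]
  congr 2

theorem mixedDeriv_zero (f : TrigPoly d) : mixedDeriv 0 f = f := by
  ext q; simp [mixedDeriv, coeff_multiplier, symbol, multiPow_zero]

theorem mixedDeriv_add_single (γ : Fin d → ℕ) (i : Fin d) (f : TrigPoly d) :
    mixedDeriv (γ + Pi.single i 1) f = mixedDeriv (Pi.single i 1) (mixedDeriv γ f) := by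
  ext q
  simp only [mixedDeriv, coeff_multiplier, symbol, multiPow_add_single, multiPow_single, mul_assoc]

theorem mixedDeriv_comm (γ γ' : Fin d → ℕ) (f : TrigPoly d) :
    mixedDeriv γ (mixedDeriv γ' f) = mixedDeriv γ' (mixedDeriv γ f) := by
  rw [mixedDeriv, mixedDeriv, multiplier_multiplier, multiplier_multiplier, mul_comm]

theorem mixedDeriv_single_character_mul (i : Fin d) (q : Fin d → ℤ) (f : TrigPoly d) :
    mixedDeriv (Pi.single i 1) (character q * f) =
      character q * ((Complex.I * q i) • f + mixedDeriv (Pi.single i 1) f) := by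
  induction f using induction_character with
  | zero => simp
  | add f g hf hg =>
    simp only [mul_add, map_add, hf, hg, smul_add]
    abel
  | smul c r =>
    simp only [mul_smul_comm, character_mul, map_smul, mixedDeriv, multiplier_character, symbol,
      multiPow_single, mul_add, ← add_smul, smul_smul, Pi.add_apply, Int.cast_add]
    congr 1
    ring

/-- The vector of the moduli `|q i|`, in which the size of a frequency `q` is measured. -/
def freqAbs (q : Fin d → ℤ) : Fin d → ℝ := fun i => |(q i : ℝ)|

theorem freqAbs_nonneg (q : Fin d → ℤ) : 0 ≤ freqAbs q := fun _ => abs_nonneg _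

theorem freqAbs_neg (q : Fin d → ℤ) : freqAbs (-q) = freqAbs q := by
  ext i
  simp [freqAbs]

theorem freqAbs_zsmul (z : ℤ) (q : Fin d → ℤ) : freqAbs (z • q) = |(z : ℝ)| • freqAbs q := by
  ext i
  simp [freqAbs, abs_mul]

theorem norm_symbol (γ : Fin d → ℕ) (q : Fin d → ℤ) : ‖symbol γ q‖ = multiPow (freqAbs q) γ := by
  simp [symbol, multiPow, freqAbs, norm_prod]

/-! ### The `L₁` norm -/

section L1Norm

open MeasureTheory
open scoped ComplexOrder

/-- Normalized Lebesgue measure on the period cell. -/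
def cellMeasure (d : ℕ) : Measure (Fin d → ℝ) :=
  ((volume.restrict (Set.Icc (0 : Fin d → ℝ) fun _ => 2 * Real.pi)) Set.univ)⁻¹ •
    volume.restrict (Set.Icc (0 : Fin d → ℝ) fun _ => 2 * Real.pi)

instance : IsProbabilityMeasure (cellMeasure d) := by
  have : NeZero (volume.restrict (Set.Icc (0 : Fin d → ℝ) fun _ => 2 * Real.pi)) := by
    constructor
    rw [Ne, Measure.restrict_eq_zero, Real.volume_Icc_pi]
    simp [Real.pi_pos]
  have : IsFiniteMeasure (volume.restrict (Set.Icc (0 : Fin d → ℝ) fun _ => 2 * Real.pi)) :=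
    isFiniteMeasure_restrict.2 isCompact_Icc.measure_ne_top
  unfold cellMeasure
  infer_instance

theorem integrable_of_continuous {E : Type*} [NormedAddCommGroup E] {g : (Fin d → ℝ) → E}
    (hg : Continuous g) : Integrable g (cellMeasure d) := by
  refine Integrable.smul_measure hg.integrableOn_Icc ?_
  rw [Measure.restrict_apply_univ, Real.volume_Icc_pi]
  simp [Real.pi_pos]

theorem integral_torusChar (q : Fin d → ℤ) :
    ∫ x, torusChar q x ∂cellMeasure d = if q = 0 then 1 else 0 := by
  split_ifs with h
  · simp [h, torusChar_zero]
  · obtain ⟨i, hi⟩ := Function.ne_iff.1 h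
    have hprod : torusChar q = fun x => ∏ j, Complex.exp (Complex.I * q j * (x j : ℂ)) := by
      funext x
      simp [torusChar, ← Complex.exp_sum, Finset.mul_sum, mul_assoc]
    have hzero : ∫ y in Set.Icc 0 (2 * Real.pi), Complex.exp (Complex.I * q i * (y : ℂ)) = 0 := by
      have hperiod : Complex.exp (Complex.I * q i * ((2 * Real.pi : ℝ) : ℂ)) = 1 :=
        Complex.exp_eq_one_iff.2 ⟨q i, by push_cast; ring⟩
      rw [integral_Icc_eq_integral_Ioc, ← intervalIntegral.integral_of_le Real.two_pi_pos.le,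
        integral_exp_mul_complex (by simpa using hi), hperiod]
      simp
    rw [cellMeasure, integral_smul_measure, ← Set.pi_univ_Icc, volume_pi, Measure.restrict_pi_pi,
      hprod, integral_fintype_prod_eq_prod (fun j (y : ℝ) => Complex.exp (Complex.I * q j * y)),
      Finset.prod_eq_zero (Finset.mem_univ i) hzero, smul_zero]

theorem integral_eval (f : TrigPoly d) : ∫ x, eval f x ∂cellMeasure d = f.coeff 0 := by
  induction f using induction_character with
  | zero => simp
  | add f g hf hg =>
    simp only [map_add, Pi.add_apply, AddMonoidAlgebra.coeff_add, Finsupp.add_apply]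
    rw [integral_add (integrable_of_continuous (by fun_prop))
      (integrable_of_continuous (by fun_prop)), hf, hg]
  | smul c q =>
    simp [eval_character, integral_const_mul, integral_torusChar, coeff_character]

/-- The `L₁(𝕋^d)` norm on trigonometric polynomials. -/
def l1Norm : Seminorm ℂ (TrigPoly d) :=
  Seminorm.of (fun f => torusL1Norm (eval f))
    (fun f g => by
      change ∫ x, ‖eval (f + g) x‖ ∂cellMeasure d ≤
        (∫ x, ‖eval f x‖ ∂cellMeasure d) + ∫ x, ‖eval g x‖ ∂cellMeasure d
      rw [← integral_add (integrable_of_continuous (by fun_prop))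
        (integrable_of_continuous (by fun_prop))]
      refine integral_mono (integrable_of_continuous (by fun_prop))
        (integrable_of_continuous (by fun_prop)) fun x => ?_
      simpa using norm_add_le (eval f x) (eval g x))
    fun c f => by
      change ∫ x, ‖eval (c • f) x‖ ∂cellMeasure d = ‖c‖ * ∫ x, ‖eval f x‖ ∂cellMeasure d
      simp [integral_const_mul]

theorem l1Norm_apply (f : TrigPoly d) : l1Norm f = torusL1Norm (eval f) := rfl

theorem l1Norm_eq_integral (f : TrigPoly d) : l1Norm f = ∫ x, ‖eval f x‖ ∂cellMeasure d := rfl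

theorem l1Norm_character_mul (q : Fin d → ℤ) (f : TrigPoly d) :
    l1Norm (character q * f) = l1Norm f := by
  simp [l1Norm_eq_integral, eval_character, norm_torusChar]

theorem l1Norm_character (q : Fin d → ℤ) : l1Norm (character q) = 1 := by
  simp [l1Norm_eq_integral, eval_character, norm_torusChar]

theorem norm_coeff_zero_mul_le (f g : TrigPoly d) (hg : ∀ x, ‖eval g x‖ ≤ 1) :
    ‖(f * g).coeff 0‖ ≤ l1Norm f := by
  rw [← integral_eval, l1Norm_eq_integral]
  refine (norm_integral_le_integral_norm _).trans ?_
  refine integral_mono (integrable_of_continuous (by fun_prop))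
    (integrable_of_continuous (by fun_prop)) fun x => ?_
  simpa using mul_le_of_le_one_right (norm_nonneg (eval f x)) (hg x)

theorem l1Norm_eq_coeff_zero {f : TrigPoly d} (hf : ∀ x, 0 ≤ eval f x) :
    (l1Norm f : ℂ) = f.coeff 0 := by
  rw [← integral_eval, l1Norm_eq_integral, ← integral_complex_ofReal]
  exact integral_congr_ae (.of_forall fun x => (Complex.eq_coe_norm_of_nonneg (hf x)).symm)

end L1Norm

/-! ### Bernstein estimates -/

/-- The Bernstein type estimates `‖D^γ f‖₁ ≤ c A^γ`, for all multi-indices `γ`. -/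
def IsBernstein (c : ℝ) (A : Fin d → ℝ) (f : TrigPoly d) : Prop :=
  ∀ γ, l1Norm (mixedDeriv γ f) ≤ c * multiPow A γ

section Bernstein

variable {c c' : ℝ} {A : Fin d → ℝ} {f g : TrigPoly d}

theorem IsBernstein.l1Norm_le (hf : IsBernstein c A f) : l1Norm f ≤ c := by
  simpa [mixedDeriv_zero, multiPow_zero] using hf 0

theorem IsBernstein.nonneg (hf : IsBernstein c A f) : 0 ≤ c :=
  (apply_nonneg l1Norm f).trans hf.l1Norm_le

theorem IsBernstein.zero : IsBernstein 0 A (0 : TrigPoly d) := fun γ => by simp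

theorem IsBernstein.add (hf : IsBernstein c A f) (hg : IsBernstein c' A g) :
    IsBernstein (c + c') A (f + g) := fun γ => by
  rw [map_add, add_mul]
  exact (map_add_le_add l1Norm _ _).trans (add_le_add (hf γ) (hg γ))

theorem IsBernstein.smul (hf : IsBernstein c A f) (z : ℂ) : IsBernstein (‖z‖ * c) A (z • f) :=
  fun γ => by
    rw [map_smul, map_smul_eq_mul, mul_assoc]
    exact mul_le_mul_of_nonneg_left (hf γ) (norm_nonneg _)

theorem IsBernstein.mixedDeriv_single (hf : IsBernstein c A f) (i : Fin d) :
    IsBernstein (c * A i) A (mixedDeriv (Pi.single i 1) f) := fun γ => by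
  rw [mixedDeriv_comm, ← mixedDeriv_add_single, mul_assoc, ← multiPow_add_single]
  exact hf _

theorem isBernstein_one (hA : 0 ≤ A) : IsBernstein 1 A (1 : TrigPoly d) := fun γ => by
  have hsymbol : ‖symbol γ (0 : Fin d → ℤ)‖ ≤ multiPow A γ := by
    rw [norm_symbol]
    exact multiPow_le_multiPow (freqAbs_nonneg 0) (fun i => by simpa [freqAbs] using hA i) γ
  rw [← character_zero, mixedDeriv, multiplier_character, map_smul_eq_mul, l1Norm_character]
  linarith

/-- Leibniz's rule for `D^γ (e_q f)`, with the leading term `(iq)^γ e_q f` separated. -/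
theorem IsBernstein.exists_mixedDeriv_character_mul (hf : IsBernstein c A f) (q : Fin d → ℤ)
    (γ : Fin d → ℕ) :
    ∃ g, mixedDeriv γ (character q * f) = character q * (symbol γ q • f + g) ∧
      IsBernstein (c * (multiPow (freqAbs q + A) γ - multiPow (freqAbs q) γ)) A g := by
  induction γ using multiIndex_induction with
  | zero =>
    exact ⟨0, by simp [mixedDeriv_zero, symbol, multiPow_zero],
      by simpa [multiPow_zero] using IsBernstein.zero⟩
  | add_single γ i ih =>
    obtain ⟨g, hg, hB⟩ := ih
    refine ⟨symbol γ q • mixedDeriv (Pi.single i 1) f +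
      ((Complex.I * q i) • g + mixedDeriv (Pi.single i 1) g), ?_, ?_⟩
    · rw [mixedDeriv_add_single, hg, mixedDeriv_single_character_mul, symbol_add_single]
      congr 1
      rw [smul_add, smul_smul, map_add, map_smul]
      abel
    · convert! ((hf.mixedDeriv_single i).smul (symbol γ q)).add
        ((hB.smul (Complex.I * q i)).add (hB.mixedDeriv_single i)) using 1
      simp only [multiPow_add_single, norm_symbol, norm_mul, Complex.norm_I, Complex.norm_intCast,
        one_mul, Pi.add_apply, freqAbs]
      ring

theorem IsBernstein.l1Norm_mixedDeriv_character_mul_sub_le (hf : IsBernstein c A f)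
    (q : Fin d → ℤ) (γ : Fin d → ℕ) :
    l1Norm (mixedDeriv γ (character q * f) - symbol γ q • (character q * f)) ≤
      c * (multiPow (freqAbs q + A) γ - multiPow (freqAbs q) γ) := by
  obtain ⟨g, hg, hB⟩ := hf.exists_mixedDeriv_character_mul q γ
  rw [hg, mul_add, mul_smul_comm, add_sub_cancel_left, l1Norm_character_mul]
  exact hB.l1Norm_le

theorem IsBernstein.l1Norm_mixedDeriv_character_mul_le (hf : IsBernstein c A f) (q : Fin d → ℤ)
    (γ : Fin d → ℕ) :
    l1Norm (mixedDeriv γ (character q * f)) ≤ c * multiPow (freqAbs q + A) γ := by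
  have hmain : l1Norm (symbol γ q • (character q * f)) ≤ c * multiPow (freqAbs q) γ := by
    rw [map_smul_eq_mul, l1Norm_character_mul, norm_symbol, mul_comm]
    exact mul_le_mul_of_nonneg_right hf.l1Norm_le (multiPow_nonneg (freqAbs_nonneg q) γ)
  have herror := hf.l1Norm_mixedDeriv_character_mul_sub_le q γ
  have htriangle := map_add_le_add l1Norm
    (mixedDeriv γ (character q * f) - symbol γ q • (character q * f))
    (symbol γ q • (character q * f))
  rw [sub_add_cancel] at htriangle
  linarith

theorem IsBernstein.normalize (hf : IsBernstein c A f) (hc : 1 ≤ c) (hA : 0 ≤ A)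
    (hf₁ : l1Norm f ≤ 1) : IsBernstein 1 (c • A) f := fun γ => by
  rw [one_mul]
  obtain rfl | hγ := eq_or_ne γ 0
  · simpa [mixedDeriv_zero, multiPow_zero] using hf₁
  · exact (hf γ).trans (mul_multiPow_le_multiPow_smul hA hc hγ)

end Bernstein

/-! ### Spectra -/

section Spectrum

open AddMonoidAlgebra

variable {f g : TrigPoly d}

theorem character_mem_supported {q : Fin d → ℤ} {S : Set (Fin d → ℤ)} (hq : q ∈ S) :
    character q ∈ supported ℂ ℂ S := by
  refine mem_supported'.2 fun r hr => ?_
  rw [coeff_character, if_neg]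
  rintro rfl
  exact hr hq

theorem multiplier_mem_supported {S : Set (Fin d → ℤ)} (σ : (Fin d → ℤ) → ℂ)
    (hf : f ∈ supported ℂ ℂ S) : multiplier σ f ∈ supported ℂ ℂ S :=
  mem_supported'.2 fun q hq => by rw [coeff_multiplier, mem_supported'.1 hf q hq, mul_zero]

theorem coeff_zero_mul_character_neg (f : TrigPoly d) (q : Fin d → ℤ) :
    (f * character (-q)).coeff 0 = f.coeff q := by
  rw [character, AddMonoidAlgebra.coeff_mul_single_eq_coeff_mul q fun r _ => add_neg_eq_zero,
    mul_one]

theorem coeff_zero_mul {S T : Set (Fin d → ℤ)} (hf : f ∈ supported ℂ ℂ S)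
    (hg : g ∈ supported ℂ ℂ T) (hST : ∀ q ∈ T, -q ∈ S → q = 0) :
    (f * g).coeff 0 = f.coeff 0 * g.coeff 0 := by
  rw [coeff_mul_apply_right, Finsupp.sum, Finset.sum_eq_single 0]
  · simp
  · intro q hq hq0
    rw [zero_add, mem_supported'.1 hf (-q), zero_mul]
    exact fun hqS => hq0 (hST q (mem_supported.1 hg hq) hqS)
  · intro h0
    simp [Finsupp.notMem_support_iff.1 h0]

/-- The polynomials all of whose frequencies `q` satisfy `|q i| ≤ ρ i` for every `i`. -/
def degLE (ρ : Fin d → ℝ) : Submodule ℂ (TrigPoly d) := supported ℂ ℂ {q | freqAbs q ≤ ρ}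

theorem degLE_mono {ρ ρ' : Fin d → ℝ} (h : ρ ≤ ρ') (hf : f ∈ degLE ρ) : f ∈ degLE ρ' :=
  mem_supported.2 fun _ hq => (mem_supported.1 hf hq).trans h

theorem one_mem_degLE {ρ : Fin d → ℝ} (hρ : 0 ≤ ρ) : (1 : TrigPoly d) ∈ degLE ρ :=
  character_mem_supported fun i => by simpa [freqAbs] using hρ i

theorem mul_mem_degLE {ρ ρ' : Fin d → ℝ} (hf : f ∈ degLE ρ) (hg : g ∈ degLE ρ') :
    f * g ∈ degLE (ρ + ρ') := by
  refine mem_supported.2 fun q hq => ?_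
  obtain ⟨r, hr, t, ht, rfl⟩ := Finset.mem_add.1 (support_coeff_mul_subset f g hq)
  intro i
  have htriangle := abs_add_le (r i : ℝ) (t i)
  rw [← Int.cast_add] at htriangle
  exact htriangle.trans (add_le_add (mem_supported.1 hf hr i) (mem_supported.1 hg ht i))

theorem mul_mem_degLE_two_smul {ρ : Fin d → ℝ} (hf : f ∈ degLE ρ) (hg : g ∈ degLE ρ) :
    f * g ∈ degLE ((2 : ℝ) • ρ) :=
  two_smul ℝ ρ ▸ mul_mem_degLE hf hg

/-- The polynomials in the single variable `⟨a, x⟩`: all frequencies are multiples of `a`. -/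
def alongRay (a : Fin d → ℤ) : Submodule ℂ (TrigPoly d) :=
  supported ℂ ℂ (AddSubgroup.zmultiples a : Set (Fin d → ℤ))

theorem character_zsmul_mem_alongRay (a : Fin d → ℤ) (z : ℤ) : character (z • a) ∈ alongRay a :=
  character_mem_supported (AddSubgroup.mem_zmultiples_iff.2 ⟨z, rfl⟩)

theorem character_mem_alongRay (a : Fin d → ℤ) : character a ∈ alongRay a := by
  simpa using character_zsmul_mem_alongRay a 1

theorem character_neg_mem_alongRay (a : Fin d → ℤ) : character (-a) ∈ alongRay a := by
  simpa using character_zsmul_mem_alongRay a (-1)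

theorem one_mem_alongRay (a : Fin d → ℤ) : (1 : TrigPoly d) ∈ alongRay a := by
  simpa [character_zero] using character_zsmul_mem_alongRay a 0

theorem mul_mem_alongRay {a : Fin d → ℤ} (hf : f ∈ alongRay a) (hg : g ∈ alongRay a) :
    f * g ∈ alongRay a := by
  refine mem_supported.2 fun q hq => ?_
  obtain ⟨r, hr, t, ht, rfl⟩ := Finset.mem_add.1 (support_coeff_mul_subset f g hq)
  exact add_mem (mem_supported.1 hf hr) (mem_supported.1 hg ht)

theorem coeff_zero_mul_of_mem_degLE_of_mem_alongRay {ρ : Fin d → ℝ} {a : Fin d → ℤ}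
    (hf : f ∈ degLE ρ) (hg : g ∈ alongRay a) {i : Fin d} (hi : ρ i < freqAbs a i) :
    (f * g).coeff 0 = f.coeff 0 * g.coeff 0 := by
  refine coeff_zero_mul hf hg fun q hq hqρ => ?_
  obtain ⟨z, rfl⟩ := AddSubgroup.mem_zmultiples_iff.1 hq
  by_contra hne
  have hz : (1 : ℝ) ≤ |(z : ℝ)| := by
    exact_mod_cast Int.one_le_abs (left_ne_zero_of_smul hne)
  have hle : freqAbs (-(z • a)) i ≤ ρ i := hqρ i
  rw [← neg_smul, freqAbs_zsmul, Int.cast_neg, abs_neg, Pi.smul_apply, smul_eq_mul] at hle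
  have := le_mul_of_one_le_left (freqAbs_nonneg a i) hz
  linarith

end Spectrum

/-! ### Fejér kernels -/

section Fejer

open AddMonoidAlgebra
open scoped ComplexOrder

/-- The Fejér kernel of order `M` in the variable `⟨a, x⟩`. It is nonnegative with mean `1`, and
its frequencies are the `z • a` with `|z| < M`. -/
def fejer (M : ℕ) (a : Fin d → ℤ) : TrigPoly d :=
  (M : ℂ)⁻¹ •
    ((∑ j ∈ Finset.range M, character a ^ j) * ∑ j ∈ Finset.range M, character (-a) ^ j)

theorem eval_fejer_nonneg (M : ℕ) (a : Fin d → ℤ) (x : Fin d → ℝ) : 0 ≤ eval (fejer M a) x := by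
  have hconj : ∑ j ∈ Finset.range M, torusChar (-a) x ^ j =
      star (∑ j ∈ Finset.range M, torusChar a x ^ j) := by
    simp [torusChar_neg]
  simp only [fejer, map_smul, map_mul, map_sum, map_pow, eval_character, Pi.smul_apply,
    Pi.mul_apply, Finset.sum_apply, Pi.pow_apply, smul_eq_mul, hconj]
  exact mul_nonneg (by positivity) (mul_star_self_nonneg _)

variable {M : ℕ} {a : Fin d → ℤ}

theorem fejer_sub_one (hM : M ≠ 0) :
    fejer M a - 1 = (M : ℂ)⁻¹ •
      ∑ p ∈ (Finset.range M).offDiag, character (((p.1 : ℤ) - p.2) • a) := by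
  have hterm : ∀ j l : ℕ, character a ^ j * character (-a) ^ l =
      character (((j : ℤ) - l) • a) := fun j l => by
    rw [character_pow, character_pow, character_mul, sub_smul, natCast_zsmul, natCast_zsmul,
      smul_neg, sub_eq_add_neg]
  have hdiag : ∑ p ∈ (Finset.range M).diag, character (((p.1 : ℤ) - p.2) • a) =
      (M : ℂ) • (1 : TrigPoly d) := by
    simp [Finset.sum_diag, character_zero, Algebra.smul_def]
  simp only [fejer, Finset.sum_mul_sum, hterm]
  rw [← Finset.sum_product', ← Finset.diag_union_offDiag,
    Finset.sum_union (Finset.disjoint_diag_offDiag _), hdiag, smul_add,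
    inv_smul_smul₀ (Nat.cast_ne_zero.2 hM), add_sub_cancel_left]

theorem ne_zero_and_abs_le_of_mem_offDiag_range {p : ℕ × ℕ}
    (hp : p ∈ (Finset.range M).offDiag) : (p.1 : ℤ) - p.2 ≠ 0 ∧ |(p.1 : ℤ) - p.2| ≤ M := by
  simp only [Finset.mem_offDiag, Finset.mem_range] at hp
  rw [abs_le]
  omega

theorem fejer_sub_one_mem (S : Submodule ℂ (TrigPoly d)) (hM : M ≠ 0)
    (hS : ∀ z : ℤ, z ≠ 0 → |z| ≤ M → character (z • a) ∈ S) : fejer M a - 1 ∈ S := by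
  rw [fejer_sub_one hM]
  refine S.smul_mem _ (S.sum_mem fun p hp => ?_)
  exact (ne_zero_and_abs_le_of_mem_offDiag_range hp).elim (hS _)

theorem seminorm_fejer_sub_one_le (p : Seminorm ℂ (TrigPoly d)) (hM : M ≠ 0) {B : ℝ}
    (hB : ∀ z : ℤ, z ≠ 0 → |z| ≤ M → p (character (z • a)) ≤ B) :
    p (fejer M a - 1) ≤ (M - 1) * B := by
  have hM₀ : (M : ℝ) ≠ 0 := Nat.cast_ne_zero.2 hM
  rw [fejer_sub_one hM, map_smul_eq_mul, norm_inv, Complex.norm_natCast,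
    inv_mul_le_iff₀ (by positivity)]
  calc p (∑ r ∈ (Finset.range M).offDiag, character (((r.1 : ℤ) - r.2) • a))
      ≤ ∑ r ∈ (Finset.range M).offDiag, p (character (((r.1 : ℤ) - r.2) • a)) :=
        Finset.le_sum_of_subadditive p (map_zero p).le (map_add_le_add p) _ _
    _ ≤ (Finset.range M).offDiag.card • B := Finset.sum_le_card_nsmul _ _ _ fun r hr =>
        (ne_zero_and_abs_le_of_mem_offDiag_range hr).elim (hB _)
    _ = M * ((M - 1) * B) := by
        rw [Finset.offDiag_card, Finset.card_range, nsmul_eq_mul,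
          Nat.cast_sub (Nat.le_mul_self M)]
        push_cast
        ring

theorem seminorm_fejer_le (p : Seminorm ℂ (TrigPoly d)) (hM : M ≠ 0) {B : ℝ}
    (hB : ∀ z : ℤ, |z| ≤ M → p (character (z • a)) ≤ B) : p (fejer M a) ≤ M * B := by
  have hone : p 1 ≤ B := by simpa [character_zero] using hB 0 (by simp)
  have htriangle := map_add_le_add p (fejer M a - 1) 1
  rw [sub_add_cancel] at htriangle
  linarith [seminorm_fejer_sub_one_le p hM fun z _ => hB z]

theorem fejer_mem_alongRay (hM : M ≠ 0) : fejer M a ∈ alongRay a := by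
  rw [← sub_add_cancel (fejer M a) 1]
  exact add_mem (fejer_sub_one_mem _ hM fun z _ _ => character_zsmul_mem_alongRay a z)
    (one_mem_alongRay a)

theorem fejer_mem_degLE (hM : M ≠ 0) : fejer M a ∈ degLE ((M : ℝ) • freqAbs a) := by
  rw [← sub_add_cancel (fejer M a) 1]
  refine add_mem (fejer_sub_one_mem _ hM fun z _ hz => character_mem_supported ?_)
    (one_mem_degLE (smul_nonneg (by positivity) (freqAbs_nonneg a)))
  rw [Set.mem_ofPred_eq, freqAbs_zsmul]
  exact smul_le_smul_of_nonneg_right (by exact_mod_cast hz) (freqAbs_nonneg a)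

theorem fejer_sub_one_mem_supported_ne_zero (hM : M ≠ 0) (ha : a ≠ 0) :
    fejer M a - 1 ∈ supported ℂ ℂ {q | q ≠ 0} :=
  fejer_sub_one_mem _ hM fun _ hz _ => character_mem_supported (smul_ne_zero hz ha)

theorem coeff_zero_fejer (hM : M ≠ 0) (ha : a ≠ 0) : (fejer M a).coeff 0 = 1 := by
  have := mem_supported'.1 (fejer_sub_one_mem_supported_ne_zero hM ha) 0 (by simp)
  rw [coeff_sub, Finsupp.sub_apply, ← character_zero, coeff_character, if_pos rfl] at this
  exact sub_eq_zero.1 this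

theorem IsBernstein.fejer_mul {c : ℝ} {A : Fin d → ℝ} {f : TrigPoly d} (hf : IsBernstein c A f)
    (hA : 0 ≤ A) (hM : M ≠ 0) :
    IsBernstein (M * c) ((M : ℝ) • freqAbs a + A) (fejer M a * f) := fun γ => by
  rw [mul_assoc]
  refine seminorm_fejer_le (l1Norm.comp (mixedDeriv γ ∘ₗ LinearMap.mulRight ℂ f)) hM fun z hz => ?_
  refine (hf.l1Norm_mixedDeriv_character_mul_le _ γ).trans ?_
  refine mul_le_mul_of_nonneg_left ?_ hf.nonneg
  refine multiPow_le_multiPow (add_nonneg (freqAbs_nonneg _) hA) (add_le_add_left ?_ A) γ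
  rw [freqAbs_zsmul]
  exact smul_le_smul_of_nonneg_right (by exact_mod_cast hz) (freqAbs_nonneg a)

end Fejer

/-! ### Riesz products -/

section Riesz

open scoped ComplexOrder

/-- The Riesz product of the first `k` Fejér kernels with frequencies `a j` and orders `M j`. -/
def riesz (a : ℕ → Fin d → ℤ) (M : ℕ → ℕ) (k : ℕ) : TrigPoly d :=
  ∏ j ∈ Finset.range k, fejer (M j) (a j)

/-- A bound for the frequencies of `riesz a M k` in every coordinate. The outer factor `M k` in the
recursion makes room for the Bernstein estimates `isBernstein_riesz`. -/
def scale (a : ℕ → Fin d → ℤ) (M : ℕ → ℕ) : ℕ → Fin d → ℝ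
  | 0 => 0
  | k + 1 => (M k : ℝ) • ((M k : ℝ) • freqAbs (a k) + scale a M k)

/-- The frequencies `a k` are positive and grow so rapidly that those of the Riesz product
`riesz a M k` are at most `δ • a k`. -/
structure Lacunary (a : ℕ → Fin d → ℤ) (M : ℕ → ℕ) (δ : ℝ) : Prop where
  pos : ∀ k i, 0 < a k i
  two_le : ∀ k, 2 ≤ M k
  nonneg : 0 ≤ δ
  le_quarter : δ ≤ 1 / 4
  scale_le : ∀ k, scale a M k ≤ δ • freqAbs (a k)

variable {a : ℕ → Fin d → ℤ} {M : ℕ → ℕ} {δ : ℝ}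

theorem riesz_zero : riesz a M 0 = 1 := Finset.prod_range_zero _

theorem riesz_succ (k : ℕ) : riesz a M (k + 1) = riesz a M k * fejer (M k) (a k) :=
  Finset.prod_range_succ _ _

theorem eval_riesz_nonneg (k : ℕ) (x : Fin d → ℝ) : 0 ≤ eval (riesz a M k) x := by
  rw [riesz, map_prod, Finset.prod_apply]
  exact Finset.prod_nonneg fun j _ => eval_fejer_nonneg _ _ x

theorem scale_nonneg (k : ℕ) : 0 ≤ scale a M k := by
  induction k with
  | zero => exact le_rfl
  | succ k ih =>
    exact smul_nonneg (Nat.cast_nonneg _)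
      (add_nonneg (smul_nonneg (Nat.cast_nonneg _) (freqAbs_nonneg _)) ih)

namespace Lacunary

variable (h : Lacunary a M δ)

include h

theorem order_ne_zero (k : ℕ) : M k ≠ 0 := (zero_lt_two.trans_le (h.two_le k)).ne'

theorem one_le_order (k : ℕ) : (1 : ℝ) ≤ M k := by
  exact_mod_cast Nat.one_le_iff_ne_zero.2 (h.order_ne_zero k)

theorem freqAbs_apply_pos (k : ℕ) (i : Fin d) : 0 < freqAbs (a k) i :=
  abs_pos.2 (Int.cast_ne_zero.2 (h.pos k i).ne')

theorem ne_zero [NeZero d] (k : ℕ) : a k ≠ 0 := fun h0 => by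
  simpa [h0] using h.pos k 0

theorem smul_add_scale_le (k : ℕ) :
    (M k : ℝ) • freqAbs (a k) + scale a M k ≤ scale a M (k + 1) :=
  le_smul_of_one_le_left
    (add_nonneg (smul_nonneg (Nat.cast_nonneg _) (freqAbs_nonneg _)) (scale_nonneg k))
    (h.one_le_order k)

theorem scale_mono : Monotone (scale a M) :=
  monotone_nat_of_le_succ fun k => (le_add_of_nonneg_left
    (smul_nonneg (Nat.cast_nonneg _) (freqAbs_nonneg _))).trans (h.smul_add_scale_le k)

theorem two_mul_scale_lt (k : ℕ) (i : Fin d) : 2 * scale a M k i < freqAbs (a k) i := by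
  have hpos := h.freqAbs_apply_pos k i
  have hle : scale a M k i ≤ δ * freqAbs (a k) i := h.scale_le k i
  nlinarith [h.le_quarter]

theorem coeff_zero_mul [NeZero d] {k : ℕ} {f g : TrigPoly d}
    (hf : f ∈ degLE ((2 : ℝ) • scale a M k)) (hg : g ∈ alongRay (a k)) :
    (f * g).coeff 0 = f.coeff 0 * g.coeff 0 :=
  coeff_zero_mul_of_mem_degLE_of_mem_alongRay hf hg (h.two_mul_scale_lt k 0)

theorem riesz_mem_degLE (k : ℕ) : riesz a M k ∈ degLE (scale a M k) := by
  induction k with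
  | zero => exact riesz_zero ▸ one_mem_degLE (scale_nonneg 0)
  | succ k ih =>
    rw [riesz_succ, mul_comm]
    exact degLE_mono (h.smul_add_scale_le k)
      (mul_mem_degLE (fejer_mem_degLE (h.order_ne_zero k)) ih)

theorem coeff_zero_riesz [NeZero d] (k : ℕ) : (riesz a M k).coeff 0 = 1 := by
  induction k with
  | zero => simp [riesz_zero]
  | succ k ih =>
    have hdeg : riesz a M k ∈ degLE ((2 : ℝ) • scale a M k) :=
      degLE_mono (two_smul ℝ (scale a M k) ▸ le_add_of_nonneg_left (scale_nonneg k))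
        (h.riesz_mem_degLE k)
    rw [riesz_succ, h.coeff_zero_mul hdeg (fejer_mem_alongRay (h.order_ne_zero k)), ih,
      coeff_zero_fejer (h.order_ne_zero k) (h.ne_zero k), mul_one]

theorem l1Norm_riesz [NeZero d] (k : ℕ) : l1Norm (riesz a M k) = 1 := by
  have := l1Norm_eq_coeff_zero (eval_riesz_nonneg (a := a) (M := M) k)
  rw [h.coeff_zero_riesz k] at this
  exact_mod_cast this

theorem isBernstein_riesz [NeZero d] (k : ℕ) : IsBernstein 1 (scale a M k) (riesz a M k) := by
  induction k with
  | zero => exact riesz_zero ▸ isBernstein_one (scale_nonneg 0)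
  | succ k ih =>
    refine IsBernstein.normalize ?_ (h.one_le_order k)
      (add_nonneg (smul_nonneg (Nat.cast_nonneg _) (freqAbs_nonneg _)) (scale_nonneg k))
      (h.l1Norm_riesz (k + 1)).le
    have := ih.fejer_mul (a := a k) (scale_nonneg k) (h.order_ne_zero k)
    rwa [mul_one, mul_comm, ← riesz_succ] at this

end Lacunary

end Riesz

/-! ### The blocks of the extremal polynomial -/

section Block

open AddMonoidAlgebra

/-- The modulus of the symbol of `D^γ / D^α` at the frequency `q`. -/
def ratio (γ α : Fin d → ℕ) (q : Fin d → ℤ) : ℝ :=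
  multiPow (freqAbs q) γ / multiPow (freqAbs q) α

theorem norm_symbol_div (γ α : Fin d → ℕ) (q : Fin d → ℤ) :
    ‖symbol γ q / symbol α q‖ = ratio γ α q := by
  rw [norm_div, norm_symbol, norm_symbol, ratio]

theorem ratio_nonneg (γ α : Fin d → ℕ) (q : Fin d → ℤ) : 0 ≤ ratio γ α q :=
  norm_symbol_div γ α q ▸ norm_nonneg _

theorem ratio_self {q : Fin d → ℤ} (hq : ∀ i, q i ≠ 0) (α : Fin d → ℕ) : ratio α α q = 1 :=
  div_self (multiPow_pos (fun i => abs_pos.2 (Int.cast_ne_zero.2 (hq i))) α).ne'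

theorem ratio_zsmul_le {γ : Fin d → ℕ} {n m : ℕ} (hn : ∑ i, γ i ≤ n) {z : ℤ} (hz : z ≠ 0)
    (hzm : |z| ≤ m) (α : Fin d → ℕ) (q : Fin d → ℤ) :
    ratio γ α (z • q) ≤ m ^ n * ratio γ α q := by
  have h₁ : (1 : ℝ) ≤ |(z : ℝ)| := by exact_mod_cast Int.one_le_abs hz
  have hm : |(z : ℝ)| ≤ m := by exact_mod_cast hzm
  rw [ratio, freqAbs_zsmul, multiPow_smul, multiPow_smul, mul_div_mul_comm]
  refine mul_le_mul_of_nonneg_right ?_ (ratio_nonneg γ α q)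
  calc |(z : ℝ)| ^ (∑ i, γ i) / |(z : ℝ)| ^ (∑ i, α i)
      ≤ |(z : ℝ)| ^ (∑ i, γ i) := div_le_self (by positivity) (one_le_pow₀ h₁)
    _ ≤ |(z : ℝ)| ^ n := pow_le_pow_right₀ h₁ hn
    _ ≤ (m : ℝ) ^ n := pow_le_pow_left₀ (abs_nonneg _) hm n

theorem symbol_ne_zero {q : Fin d → ℤ} (hq : ∀ i, q i ≠ 0) (α : Fin d → ℕ) : symbol α q ≠ 0 :=
  norm_pos_iff.1 (norm_symbol α q ▸
    multiPow_pos (fun i => abs_pos.2 (Int.cast_ne_zero.2 (hq i))) α)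

/-- The kernel of `D^γ / D^α` along the ray of `a`: the Fejér kernel with its constant term removed
and the multiplier of `D^γ / D^α` applied. -/
def rayKernel (γ α : Fin d → ℕ) (M : ℕ) (a : Fin d → ℤ) : TrigPoly d :=
  multiplier (symbol γ / symbol α) (fejer M a - 1)

/-- The polynomial that `D^γ / D^α` yields from `riesz a M (k + 1) - riesz a M k` when it acts only
on the new factor. Thus `block 0 α a M k` is an approximate `D^α`-primitive of that difference, and
`block γ α a M k` is the leading part of `D^γ (block 0 α a M k)`. -/
def block (γ α : Fin d → ℕ) (a : ℕ → Fin d → ℤ) (M : ℕ → ℕ) (k : ℕ) : TrigPoly d :=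
  rayKernel γ α (M k) (a k) * riesz a M k

theorem rayKernel_mem (S : Set (Fin d → ℤ)) (γ α : Fin d → ℕ) {M : ℕ} (hM : M ≠ 0)
    (a : Fin d → ℤ) (hS : ∀ z : ℤ, z ≠ 0 → |z| ≤ M → z • a ∈ S) :
    rayKernel γ α M a ∈ supported ℂ ℂ S :=
  multiplier_mem_supported _ (fejer_sub_one_mem _ hM fun z hz hzM =>
    character_mem_supported (hS z hz hzM))

theorem seminorm_fejer_sub_one_le_mul_ratio (p : Seminorm ℂ (TrigPoly d)) {γ α : Fin d → ℕ}
    {n M : ℕ} (hn : ∑ i, γ i ≤ n) (hM : M ≠ 0) {c : ℝ} (hc : 0 ≤ c) {a : Fin d → ℤ}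
    (hp : ∀ z : ℤ, z ≠ 0 → p (character (z • a)) ≤ c * ratio γ α (z • a)) :
    p (fejer M a - 1) ≤ M ^ (n + 1) * (c * ratio γ α a) := by
  have hr := ratio_nonneg γ α a
  calc p (fejer M a - 1) ≤ (M - 1) * (c * (M ^ n * ratio γ α a)) :=
        seminorm_fejer_sub_one_le p hM fun z hz hzM =>
          (hp z hz).trans (mul_le_mul_of_nonneg_left (ratio_zsmul_le hn hz hzM α a) hc)
    _ ≤ M * (c * (M ^ n * ratio γ α a)) := by gcongr; linarith
    _ = M ^ (n + 1) * (c * ratio γ α a) := by ring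

variable {a : ℕ → Fin d → ℤ} {M : ℕ → ℕ} {δ : ℝ} {γ : Fin d → ℕ} {n : ℕ}

namespace Lacunary

variable (h : Lacunary a M δ)

include h

theorem rayKernel_self (α : Fin d → ℕ) (k : ℕ) :
    rayKernel α α (M k) (a k) = fejer (M k) (a k) - 1 := by
  refine fejer_sub_one_mem (LinearMap.eqLocus (multiplier (symbol α / symbol α)) LinearMap.id)
    (h.order_ne_zero k) fun z hz _ => ?_
  have hsymbol : symbol α (z • a k) ≠ 0 :=
    symbol_ne_zero (fun i => mul_ne_zero hz (h.pos k i).ne') α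
  rw [LinearMap.mem_eqLocus, multiplier_character, Pi.div_apply, div_self hsymbol, one_smul,
    LinearMap.id_apply]

theorem block_self (α : Fin d → ℕ) (k : ℕ) :
    block α α a M k = riesz a M (k + 1) - riesz a M k := by
  rw [block, h.rayKernel_self, riesz_succ]
  ring

theorem rayKernel_mem_alongRay (γ α : Fin d → ℕ) (k : ℕ) :
    rayKernel γ α (M k) (a k) ∈ alongRay (a k) :=
  rayKernel_mem _ γ α (h.order_ne_zero k) _ fun z _ _ => ⟨z, rfl⟩

theorem rayKernel_mem_degLE (γ α : Fin d → ℕ) (k : ℕ) :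
    rayKernel γ α (M k) (a k) ∈ degLE ((M k : ℝ) • freqAbs (a k)) := by
  refine rayKernel_mem _ γ α (h.order_ne_zero k) _ fun z _ hz => ?_
  rw [Set.mem_ofPred_eq, freqAbs_zsmul]
  exact smul_le_smul_of_nonneg_right (by exact_mod_cast hz) (freqAbs_nonneg _)

theorem block_mem_degLE (γ α : Fin d → ℕ) (k : ℕ) :
    block γ α a M k ∈ degLE (scale a M (k + 1)) :=
  degLE_mono (h.smul_add_scale_le k)
    (mul_mem_degLE (h.rayKernel_mem_degLE γ α k) (h.riesz_mem_degLE k))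

theorem l1Norm_block_le [NeZero d] (α : Fin d → ℕ) (hn : ∑ i, γ i ≤ n) (k : ℕ) :
    l1Norm (block γ α a M k) ≤ M k ^ (n + 1) * ratio γ α (a k) := by
  rw [← one_mul (ratio γ α (a k))]
  refine seminorm_fejer_sub_one_le_mul_ratio
    (l1Norm.comp (LinearMap.mulRight ℂ (riesz a M k) ∘ₗ multiplier (symbol γ / symbol α)))
    hn (h.order_ne_zero k) zero_le_one fun z _ => ?_
  change l1Norm (multiplier (symbol γ / symbol α) (character (z • a k)) * riesz a M k) ≤ _
  rw [multiplier_character, smul_mul_assoc, map_smul_eq_mul, l1Norm_character_mul,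
    h.l1Norm_riesz, Pi.div_apply, norm_symbol_div, mul_one, one_mul]

theorem multiPow_add_scale_sub_le (hn : ∑ i, γ i ≤ n) (k : ℕ) {z : ℤ} (hz : z ≠ 0) :
    multiPow (freqAbs (z • a k) + scale a M k) γ - multiPow (freqAbs (z • a k)) γ ≤
      2 ^ n * δ * multiPow (freqAbs (z • a k)) γ := by
  refine multiPow_add_sub_multiPow_le (freqAbs_nonneg _) (scale_nonneg k) h.nonneg
    (h.le_quarter.trans (by norm_num)) ((h.scale_le k).trans ?_) γ hn
  rw [freqAbs_zsmul]
  refine smul_le_smul_of_nonneg_left (le_smul_of_one_le_left (freqAbs_nonneg _) ?_) h.nonneg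
  exact_mod_cast Int.one_le_abs hz

theorem l1Norm_mixedDeriv_block_sub_block_le [NeZero d] (α : Fin d → ℕ) (hn : ∑ i, γ i ≤ n)
    (k : ℕ) :
    l1Norm (mixedDeriv γ (block 0 α a M k) - block γ α a M k) ≤
      M k ^ (n + 1) * (2 ^ n * δ * ratio γ α (a k)) := by
  let R := LinearMap.mulRight ℂ (riesz a M k)
  let error : TrigPoly d →ₗ[ℂ] TrigPoly d := mixedDeriv γ ∘ₗ R ∘ₗ multiplier (symbol 0 / symbol α) -
    R ∘ₗ multiplier (symbol γ / symbol α)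
  have hδ := h.nonneg
  refine seminorm_fejer_sub_one_le_mul_ratio (l1Norm.comp error) hn (h.order_ne_zero k)
    (by positivity) fun z hz => ?_
  have herror : error (character (z • a k)) = (symbol α (z • a k))⁻¹ •
      (mixedDeriv γ (character (z • a k) * riesz a M k) -
        symbol γ (z • a k) • (character (z • a k) * riesz a M k)) := by
    simp [error, R, multiplier_character, smul_sub, smul_smul, div_eq_inv_mul, symbol,
      multiPow_zero]
  have hB := (h.isBernstein_riesz k).l1Norm_mixedDeriv_character_mul_sub_le (z • a k) γ
  rw [one_mul] at hB
  rw [Seminorm.comp_apply, herror, map_smul_eq_mul, norm_inv, norm_symbol, ratio, mul_div_assoc',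
    ← div_eq_inv_mul]
  exact div_le_div_of_nonneg_right (hB.trans (h.multiPow_add_scale_sub_le hn k hz))
    (multiPow_nonneg (freqAbs_nonneg _) α)

theorem l1Norm_mixedDeriv_block_le [NeZero d] (α : Fin d → ℕ) (hn : ∑ i, γ i ≤ n)
    (hδ : 2 ^ n * δ ≤ 1) (k : ℕ) :
    l1Norm (mixedDeriv γ (block 0 α a M k)) ≤ 2 * (M k ^ (n + 1) * ratio γ α (a k)) := by
  have hleading := h.l1Norm_block_le α hn k
  have herror := h.l1Norm_mixedDeriv_block_sub_block_le α hn k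
  have htriangle := map_add_le_add l1Norm (mixedDeriv γ (block 0 α a M k) - block γ α a M k)
    (block γ α a M k)
  rw [sub_add_cancel] at htriangle
  have hr := ratio_nonneg γ α (a k)
  have : (M k : ℝ) ^ (n + 1) * (2 ^ n * δ * ratio γ α (a k)) ≤
      M k ^ (n + 1) * (1 * ratio γ α (a k)) := by gcongr
  linarith

end Lacunary

end Block

/-! ### The test function -/

section Detector

open AddMonoidAlgebra

theorem sum_prod_mul_one_sub {R : Type*} [CommRing R] (t : ℕ → R) (n : ℕ) :
    ∑ j ∈ Finset.range n, (∏ i ∈ Finset.range j, t i) * (1 - t j) =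
      1 - ∏ i ∈ Finset.range n, t i := by
  induction n with
  | zero => simp
  | succ n ih =>
    rw [Finset.sum_range_succ, ih, Finset.prod_range_succ]
    ring

theorem one_sub_mul_one_sub_character_neg (q : Fin d → ℤ) :
    (1 - character q) * (1 - character (-q)) = 1 + 1 - character q - character (-q) := by
  linear_combination character_mul q (-q) + congrArg character (add_neg_cancel q) + character_zero

theorem coeff_zero_one_sub_mul_one_sub {q : Fin d → ℤ} (hq : q ≠ 0) :
    ((1 - character q) * (1 - character (-q))).coeff 0 = 2 := by
  rw [one_sub_mul_one_sub_character_neg]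
  norm_num [coeff_character, hq]

/-- The function `sin² (⟨q, x⟩ / 2)`. -/
def sinSqHalf (q : Fin d → ℤ) : TrigPoly d :=
  (1 / 4 : ℂ) • ((1 - character q) * (1 - character (-q)))

theorem eval_sinSqHalf (q : Fin d → ℤ) (x : Fin d → ℝ) :
    eval (sinSqHalf q) x = (((1 - (torusChar q x).re) / 2 : ℝ) : ℂ) := by
  have hadd := Complex.add_conj (torusChar q x)
  have hmul : torusChar q x * (starRingEnd ℂ) (torusChar q x) = 1 := by
    simp [Complex.mul_conj, Complex.normSq_eq_norm_sq, norm_torusChar]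
  simp only [sinSqHalf, map_smul, map_mul, map_sub, map_one, eval_character, torusChar_neg,
    Pi.smul_apply, Pi.mul_apply, Pi.sub_apply, Pi.one_apply, smul_eq_mul]
  push_cast at hadd ⊢
  linear_combination (1 / 4) * hmul - (1 / 4) * hadd

theorem coeff_zero_sinSqHalf {q : Fin d → ℤ} (hq : q ≠ 0) : (sinSqHalf q).coeff 0 = 1 / 2 := by
  rw [sinSqHalf, coeff_smul, Finsupp.smul_apply, coeff_zero_one_sub_mul_one_sub hq, smul_eq_mul]
  norm_num

theorem sinSqHalf_mem_alongRay (q : Fin d → ℤ) : sinSqHalf q ∈ alongRay q :=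
  Submodule.smul_mem _ _ (mul_mem_alongRay
    (sub_mem (one_mem_alongRay q) (character_mem_alongRay q))
    (sub_mem (one_mem_alongRay q) (character_neg_mem_alongRay q)))

theorem sinSqHalf_mem_degLE (q : Fin d → ℤ) : sinSqHalf q ∈ degLE (freqAbs q) := by
  have hq : character q ∈ degLE (freqAbs q) := character_mem_supported (le_refl (freqAbs q))
  have hneg : character (-q) ∈ degLE (freqAbs q) :=
    character_mem_supported (freqAbs_neg q).le
  have h1 := one_mem_degLE (freqAbs_nonneg q)
  rw [sinSqHalf, one_sub_mul_one_sub_character_neg]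
  exact Submodule.smul_mem _ _ (sub_mem (sub_mem (add_mem h1 h1) hq) hneg)

theorem coeff_zero_fejer_mul_sinSqHalf {M : ℕ} (hM : M ≠ 0) {q : Fin d → ℤ} (hq : q ≠ 0) :
    (fejer M q * sinSqHalf q).coeff 0 = (2 * M : ℂ)⁻¹ := by
  have htelescope : fejer M q * sinSqHalf q =
      ((M : ℂ)⁻¹ * (1 / 4)) • ((1 - character (M • q)) * (1 - character (-(M • q)))) := by
    rw [fejer, sinSqHalf, smul_mul_smul_comm, mul_mul_mul_comm, geom_sum_mul_neg,
      geom_sum_mul_neg, character_pow, character_pow, smul_neg]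
  rw [htelescope, coeff_smul, Finsupp.smul_apply,
    coeff_zero_one_sub_mul_one_sub (smul_ne_zero hM hq), smul_eq_mul, mul_inv]
  ring

/-- The product of the functions `cos² (⟨a (2 i + 1), x⟩ / 2)` over `i < j`. -/
def cutoff (a : ℕ → Fin d → ℤ) (j : ℕ) : TrigPoly d :=
  ∏ i ∈ Finset.range j, (1 - sinSqHalf (a (2 * i + 1)))

/-- The summand of the test function that detects the frequency `a (2 j)`. -/
def detector (a : ℕ → Fin d → ℤ) (j : ℕ) : TrigPoly d :=
  character (-a (2 * j)) * cutoff a j * sinSqHalf (a (2 * j + 1))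

theorem cutoff_succ (a : ℕ → Fin d → ℤ) (j : ℕ) :
    cutoff a (j + 1) = cutoff a j * (1 - sinSqHalf (a (2 * j + 1))) :=
  Finset.prod_range_succ _ _

theorem norm_eval_sum_detector_le (a : ℕ → Fin d → ℤ) (n : ℕ) (x : Fin d → ℝ) :
    ‖eval (∑ j ∈ Finset.range n, detector a j) x‖ ≤ 1 := by
  let t : ℕ → ℝ := fun i => 1 - (1 - (torusChar (a (2 * i + 1)) x).re) / 2
  have ht : ∀ i, 0 ≤ t i ∧ t i ≤ 1 := fun i => by
    have := Complex.abs_re_le_norm (torusChar (a (2 * i + 1)) x)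
    rw [norm_torusChar, abs_le] at this
    constructor <;> simp only [t] <;> linarith
  have hprod : ∀ j, 0 ≤ ∏ i ∈ Finset.range j, t i := fun j =>
    Finset.prod_nonneg fun i _ => (ht i).1
  have hdetector : ∀ j, ‖eval (detector a j) x‖ = (∏ i ∈ Finset.range j, t i) * (1 - t j) :=
    fun j => by
      have : eval (detector a j) x =
          torusChar (-a (2 * j)) x * (((∏ i ∈ Finset.range j, t i) * (1 - t j) : ℝ) : ℂ) := by
        simp [detector, cutoff, eval_character, eval_sinSqHalf, t, mul_assoc]
      rw [this, norm_mul, norm_torusChar, one_mul, Complex.norm_real,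
        Real.norm_of_nonneg (mul_nonneg (hprod j) (sub_nonneg.2 (ht j).2))]
  rw [map_sum, Finset.sum_apply]
  refine (norm_sum_le _ _).trans ?_
  simp only [hdetector, sum_prod_mul_one_sub]
  linarith [hprod n]

theorem coeff_rayKernel_two {a : Fin d → ℤ} (ha : a ≠ 0) (γ α : Fin d → ℕ) :
    (rayKernel γ α 2 a).coeff a = symbol γ a / symbol α a / 2 := by
  have hoff : (Finset.range 2).offDiag = {(1, 0), (0, 1)} := by decide
  have hsub : fejer 2 a - 1 = (2 : ℂ)⁻¹ • (character a + character (-a)) := by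
    rw [fejer_sub_one two_ne_zero, hoff, Finset.sum_pair (by decide)]
    simp
  have hneg : -a ≠ a := fun h => ha (neg_eq_self.1 h)
  rw [rayKernel, coeff_multiplier, hsub]
  simp [coeff_character, hneg, div_eq_mul_inv]

variable {a : ℕ → Fin d → ℤ} {M : ℕ → ℕ} {δ : ℝ}

namespace Lacunary

variable (h : Lacunary a M δ)

include h

theorem freqAbs_add_scale_le (k : ℕ) : freqAbs (a k) + scale a M k ≤ scale a M (k + 1) :=
  (add_le_add_left (le_smul_of_one_le_left (freqAbs_nonneg _)
    (h.one_le_order k)) _).trans (h.smul_add_scale_le k)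

theorem cutoff_mem_degLE (j : ℕ) : cutoff a j ∈ degLE (scale a M (2 * j)) := by
  induction j with
  | zero => exact one_mem_degLE (scale_nonneg 0)
  | succ j ih =>
    have hcos : 1 - sinSqHalf (a (2 * j + 1)) ∈ degLE (freqAbs (a (2 * j + 1))) :=
      sub_mem (one_mem_degLE (freqAbs_nonneg _)) (sinSqHalf_mem_degLE _)
    have hcutoff : cutoff a j ∈ degLE (scale a M (2 * j + 1)) :=
      degLE_mono (h.scale_mono (Nat.le_succ _)) ih
    rw [cutoff_succ, mul_comm (cutoff a j)]
    exact degLE_mono (h.freqAbs_add_scale_le (2 * j + 1)) (mul_mem_degLE hcos hcutoff)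

theorem detector_mem_degLE (j : ℕ) : detector a j ∈ degLE (scale a M (2 * (j + 1))) := by
  have hchar : character (-a (2 * j)) ∈ degLE (freqAbs (a (2 * j))) :=
    character_mem_supported (freqAbs_neg _).le
  have hcutoff : character (-a (2 * j)) * cutoff a j ∈ degLE (scale a M (2 * j + 1)) :=
    degLE_mono (h.freqAbs_add_scale_le _) (mul_mem_degLE hchar (h.cutoff_mem_degLE j))
  rw [detector, mul_comm _ (sinSqHalf _)]
  exact degLE_mono (h.freqAbs_add_scale_le (2 * j + 1))
    (mul_mem_degLE (sinSqHalf_mem_degLE _) hcutoff)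

theorem coeff_zero_mul_mul [NeZero d] {k : ℕ} {f u v : TrigPoly d}
    (hf : f ∈ degLE ((2 : ℝ) • scale a M k)) (hu : u ∈ alongRay (a k))
    (hu' : u ∈ degLE ((2 : ℝ) • (M k : ℝ) • freqAbs (a k))) (hv : v ∈ alongRay (a (k + 1))) :
    (f * u * v).coeff 0 = f.coeff 0 * u.coeff 0 * v.coeff 0 := by
  have hdeg : f * u ∈ degLE ((2 : ℝ) • scale a M (k + 1)) := by
    refine degLE_mono ?_ (mul_mem_degLE hf hu')
    rw [← smul_add, add_comm]
    exact smul_le_smul_of_nonneg_left (h.smul_add_scale_le k) zero_le_two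
  rw [h.coeff_zero_mul hdeg hv, h.coeff_zero_mul hf hu]

theorem coeff_zero_riesz_mul_cutoff [NeZero d] {b : ℕ} (hb : ∀ j, M (2 * j + 1) = b) (j : ℕ) :
    (riesz a M (2 * j) * cutoff a j).coeff 0 = (1 - (2 * b : ℂ)⁻¹) ^ j := by
  have hM := h.order_ne_zero
  induction j with
  | zero => simp [riesz_zero, cutoff]
  | succ j ih =>
    have hprod : riesz a M (2 * (j + 1)) * cutoff a (j + 1) =
        (riesz a M (2 * j) * cutoff a j) * fejer (M (2 * j)) (a (2 * j)) *
          (fejer (M (2 * j + 1)) (a (2 * j + 1)) * (1 - sinSqHalf (a (2 * j + 1)))) := by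
      rw [mul_add, mul_one, riesz_succ, riesz_succ, cutoff_succ]
      ring
    have hodd : (fejer (M (2 * j + 1)) (a (2 * j + 1)) *
        (1 - sinSqHalf (a (2 * j + 1)))).coeff 0 = 1 - (2 * b : ℂ)⁻¹ := by
      rw [mul_sub, mul_one, coeff_sub, Finsupp.sub_apply, coeff_zero_fejer (hM _) (h.ne_zero _),
        coeff_zero_fejer_mul_sinSqHalf (hM _) (h.ne_zero _), hb]
    rw [hprod, h.coeff_zero_mul_mul
        (mul_mem_degLE_two_smul (h.riesz_mem_degLE _) (h.cutoff_mem_degLE j))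
        (fejer_mem_alongRay (hM _)) (degLE_mono ?_ (fejer_mem_degLE (hM _)))
        (mul_mem_alongRay (fejer_mem_alongRay (hM _))
          (sub_mem (one_mem_alongRay _) (sinSqHalf_mem_alongRay _))),
      ih, hodd, coeff_zero_fejer (hM _) (h.ne_zero _), mul_one, pow_succ]
    exact le_smul_of_one_le_left (smul_nonneg (Nat.cast_nonneg _) (freqAbs_nonneg _)) one_le_two

theorem coeff_zero_mul_detector [NeZero d] {j : ℕ} {f u : TrigPoly d}
    (hf : f ∈ degLE (scale a M (2 * j))) (hu : u ∈ alongRay (a (2 * j)))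
    (hu' : u ∈ degLE ((M (2 * j) : ℝ) • freqAbs (a (2 * j)))) :
    (u * f * detector a j).coeff 0 = (f * cutoff a j).coeff 0 * u.coeff (a (2 * j)) / 2 := by
  have hprod : u * f * detector a j = f * cutoff a j * (u * character (-a (2 * j))) *
      sinSqHalf (a (2 * j + 1)) := by
    rw [detector]
    ring
  have hchar : character (-a (2 * j)) ∈ degLE ((M (2 * j) : ℝ) • freqAbs (a (2 * j))) :=
    character_mem_supported ((freqAbs_neg _).trans_le
      (le_smul_of_one_le_left (freqAbs_nonneg _) (h.one_le_order _)))
  rw [hprod, h.coeff_zero_mul_mul (mul_mem_degLE_two_smul hf (h.cutoff_mem_degLE j))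
    (mul_mem_alongRay hu (character_neg_mem_alongRay _)) (mul_mem_degLE_two_smul hu' hchar)
    (sinSqHalf_mem_alongRay _), coeff_zero_mul_character_neg, coeff_zero_sinSqHalf (h.ne_zero _),
    mul_one_div]

theorem coeff_zero_block_mul_detector_of_lt [NeZero d] (γ α : Fin d → ℕ) {j B : ℕ} (hj : j < B) :
    (block γ α a M (2 * B) * detector a j).coeff 0 = 0 := by
  have hdetector := degLE_mono (h.scale_mono (by omega : 2 * (j + 1) ≤ 2 * B))
    (h.detector_mem_degLE j)
  have hkernel : (rayKernel γ α (M (2 * B)) (a (2 * B))).coeff 0 = 0 :=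
    mem_supported'.1 (rayKernel_mem {q | q ≠ 0} γ α (h.order_ne_zero _) _ fun _ hz _ =>
      smul_ne_zero hz (h.ne_zero _)) 0 (by simp)
  rw [block, mul_assoc, mul_comm, h.coeff_zero_mul
    (mul_mem_degLE_two_smul (h.riesz_mem_degLE _) hdetector)
    (h.rayKernel_mem_alongRay γ α _), hkernel, mul_zero]

theorem coeff_zero_block_mul_detector_of_gt [NeZero d] (γ α : Fin d → ℕ) {j B : ℕ} (hj : B < j) :
    (block γ α a M (2 * B) * detector a j).coeff 0 = 0 := by
  have hblock := degLE_mono (h.scale_mono (by omega : 2 * B + 1 ≤ 2 * j))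
    (h.block_mem_degLE γ α (2 * B))
  rw [← one_mul (block γ α a M (2 * B)), h.coeff_zero_mul_detector hblock (one_mem_alongRay _)
    (one_mem_degLE (smul_nonneg (Nat.cast_nonneg _) (freqAbs_nonneg _))), ← character_zero,
    coeff_character, if_neg (h.ne_zero _).symm, mul_zero, zero_div]

theorem coeff_zero_block_mul_sum_detector [NeZero d] {b : ℕ} (hb : ∀ j, M (2 * j + 1) = b)
    {B n : ℕ} (hB : M (2 * B) = 2) (hBn : B < n) (γ α : Fin d → ℕ) :
    (block γ α a M (2 * B) * ∑ j ∈ Finset.range n, detector a j).coeff 0 =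
      symbol γ (a (2 * B)) / symbol α (a (2 * B)) * (1 - (2 * b : ℂ)⁻¹) ^ B / 4 := by
  rw [Finset.mul_sum, coeff_sum, Finsupp.finsetSum_apply,
    Finset.sum_eq_single_of_mem B (Finset.mem_range.2 hBn) fun j _ hj =>
      hj.lt_or_gt.elim (h.coeff_zero_block_mul_detector_of_lt γ α)
        (h.coeff_zero_block_mul_detector_of_gt γ α),
    block, h.coeff_zero_mul_detector (h.riesz_mem_degLE _) (h.rayKernel_mem_alongRay γ α _)
      (h.rayKernel_mem_degLE γ α _),
    h.coeff_zero_riesz_mul_cutoff hb, hB, coeff_rayKernel_two (h.ne_zero _)]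
  ring

end Lacunary

end Detector

/-! ### The extremal polynomial -/

section Extremal

/-- The extremal polynomial, an approximate `D^α`-primitive of `riesz a M (2 * b) - 1`. -/
def extremal (α : Fin d → ℕ) (a : ℕ → Fin d → ℤ) (M : ℕ → ℕ) (b : ℕ) : TrigPoly d :=
  ∑ k ∈ Finset.range (2 * b), block 0 α a M k

theorem sum_range_two_mul {E : Type*} [AddCommMonoid E] (g : ℕ → E) (b : ℕ) :
    ∑ k ∈ Finset.range (2 * b), g k = ∑ j ∈ Finset.range b, (g (2 * j) + g (2 * j + 1)) := by
  induction b with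
  | zero => simp
  | succ b ih =>
    rw [Finset.sum_range_succ, ← ih, mul_add, mul_one, Finset.sum_range_succ,
      Finset.sum_range_succ, add_assoc]

theorem seminorm_sum_range_le {E : Type*} [AddCommGroup E] [Module ℂ E] (p : Seminorm ℂ E)
    {f : ℕ → E} {c : ℝ} (n : ℕ) (hf : ∀ k, p (f k) ≤ c) :
    p (∑ k ∈ Finset.range n, f k) ≤ n * c :=
  calc p (∑ k ∈ Finset.range n, f k) ≤ ∑ k ∈ Finset.range n, p (f k) :=
        Finset.le_sum_of_subadditive p (map_zero p).le (map_add_le_add p) _ _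
    _ ≤ n * c := by
        simpa using Finset.sum_le_card_nsmul (Finset.range n) _ c fun k _ => hf k

theorem symbol_of_pos {q : Fin d → ℤ} (hq : ∀ i, 0 < q i) (γ : Fin d → ℕ) :
    symbol γ q = Complex.I ^ (∑ i, γ i) * (multiPow (freqAbs q) γ : ℝ) := by
  have habs : ∀ i, |(q i : ℝ)| = q i := fun i => abs_of_pos (by exact_mod_cast hq i)
  simp [symbol, multiPow, freqAbs, habs, mul_pow, Finset.prod_mul_distrib,
    Finset.prod_pow_eq_pow_sum]

theorem symbol_div_of_pos {q : Fin d → ℤ} (hq : ∀ i, 0 < q i) (γ α : Fin d → ℕ) :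
    symbol γ q / symbol α q =
      Complex.I ^ (∑ i, γ i) / Complex.I ^ (∑ i, α i) * (ratio γ α q : ℝ) := by
  rw [symbol_of_pos hq, symbol_of_pos hq, ratio, Complex.ofReal_div, mul_div_mul_comm]

theorem half_le_one_sub_pow {b j : ℕ} (hj : j < b) : (1 / 2 : ℝ) ≤ (1 - (2 * b : ℝ)⁻¹) ^ j := by
  have hb : (1 : ℝ) ≤ b := by exact_mod_cast (Nat.zero_le j).trans_lt hj
  have hinv : (2 * b : ℝ)⁻¹ ≤ 1 := inv_le_one_of_one_le₀ (by linarith)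
  calc (1 / 2 : ℝ) = 1 + b * -(2 * b : ℝ)⁻¹ := by field_simp; norm_num
    _ ≤ 1 + j * -(2 * b : ℝ)⁻¹ := by
        have : (j : ℝ) * (2 * b : ℝ)⁻¹ ≤ b * (2 * b : ℝ)⁻¹ := by gcongr
        linarith
    _ ≤ (1 - (2 * b : ℝ)⁻¹) ^ j := by
        rw [sub_eq_add_neg]
        exact one_add_mul_le_pow (by linarith) j

variable {a : ℕ → Fin d → ℤ} {M : ℕ → ℕ} {δ : ℝ} {α γ : Fin d → ℕ} {b n : ℕ}

namespace Lacunary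

variable (h : Lacunary a M δ)

include h

theorem extremal_mem_degLE (α : Fin d → ℕ) (b : ℕ) :
    extremal α a M b ∈ degLE (scale a M (2 * b)) :=
  Submodule.sum_mem _ fun k hk => degLE_mono
    (h.scale_mono (Nat.succ_le_of_lt (Finset.mem_range.1 hk))) (h.block_mem_degLE 0 α k)

theorem l1Norm_mixedDeriv_self_extremal_le [NeZero d] (hb : ∀ k, M k ≤ b) (hn : ∑ i, α i ≤ n)
    (hδ : 2 * b ^ (n + 2) * (2 ^ n * δ) ≤ 1) : l1Norm (mixedDeriv α (extremal α a M b)) ≤ 3 := by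
  have hsplit : mixedDeriv α (extremal α a M b) = (riesz a M (2 * b) - riesz a M 0) +
      ∑ k ∈ Finset.range (2 * b), (mixedDeriv α (block 0 α a M k) - block α α a M k) := by
    simp only [h.block_self]
    rw [Finset.sum_sub_distrib, Finset.sum_range_sub, add_sub_cancel, extremal, map_sum]
  have hriesz : l1Norm (riesz a M (2 * b) - riesz a M 0) ≤ 2 := by
    have := map_sub_le_add l1Norm (riesz a M (2 * b)) (riesz a M 0)
    rw [h.l1Norm_riesz, h.l1Norm_riesz] at this
    linarith
  have herror := seminorm_sum_range_le l1Norm (2 * b)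
    (f := fun k => mixedDeriv α (block 0 α a M k) - block α α a M k)
    (c := b ^ (n + 1) * (2 ^ n * δ)) fun k => by
      refine (h.l1Norm_mixedDeriv_block_sub_block_le α hn k).trans ?_
      rw [ratio_self (fun i => (h.pos k i).ne'), mul_one]
      have := h.nonneg
      have := hb k
      gcongr
  calc l1Norm (mixedDeriv α (extremal α a M b))
      ≤ 2 + (2 * b : ℕ) * (b ^ (n + 1) * (2 ^ n * δ)) :=
        hsplit ▸ (map_add_le_add l1Norm _ _).trans (add_le_add hriesz herror)
    _ = 2 + 2 * b ^ (n + 2) * (2 ^ n * δ) := by push_cast; ring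
    _ ≤ 3 := by linarith

variable (heven : ∀ j, M (2 * j) = 2) (hodd : ∀ j, M (2 * j + 1) = b) {u v : ℝ}

include heven

theorem l1Norm_sum_block_le [NeZero d] (hn : ∑ i, γ i ≤ n)
    (hu : ∀ j, ratio γ α (a (2 * j)) = u) :
    l1Norm (∑ j ∈ Finset.range b, block γ α a M (2 * j)) ≤ 2 ^ (n + 1) * (b * u) := by
  refine (seminorm_sum_range_le l1Norm b fun j => ?_).trans_eq (mul_left_comm _ _ _)
  have hblock := h.l1Norm_block_le α hn (2 * j)
  rwa [heven, hu, Nat.cast_ofNat] at hblock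

include hodd

theorem coeff_zero_sum_block_mul_sum_detector [NeZero d]
    (hu : ∀ j, ratio γ α (a (2 * j)) = u) :
    ((∑ j ∈ Finset.range b, block γ α a M (2 * j)) *
      ∑ j ∈ Finset.range b, detector a j).coeff 0 =
      Complex.I ^ (∑ i, γ i) / Complex.I ^ (∑ i, α i) *
        (∑ j ∈ Finset.range b, u * (1 - (2 * b : ℝ)⁻¹) ^ j / 4 : ℝ) := by
  rw [Finset.sum_mul, AddMonoidAlgebra.coeff_sum, Finsupp.finsetSum_apply, Complex.ofReal_sum,
    Finset.mul_sum]
  refine Finset.sum_congr rfl fun j hj => ?_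
  rw [h.coeff_zero_block_mul_sum_detector hodd (heven j) (Finset.mem_range.1 hj),
    symbol_div_of_pos (h.pos _), hu]
  push_cast
  ring

theorem le_l1Norm_sum_block [NeZero d] (hu : ∀ j, ratio γ α (a (2 * j)) = u) :
    b * u / 8 ≤ l1Norm (∑ j ∈ Finset.range b, block γ α a M (2 * j)) := by
  have hu₀ : 0 ≤ u := hu 0 ▸ ratio_nonneg _ _ _
  have hsum : b * u / 8 ≤ ∑ j ∈ Finset.range b, u * (1 - (2 * b : ℝ)⁻¹) ^ j / 4 := by
    have := Finset.card_nsmul_le_sum (Finset.range b)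
      (fun j => u * (1 - (2 * b : ℝ)⁻¹) ^ j / 4) (u / 8) fun j hj => by
        linarith [mul_le_mul_of_nonneg_left (half_le_one_sub_pow (Finset.mem_range.1 hj)) hu₀]
    rwa [Finset.card_range, nsmul_eq_mul, ← mul_div_assoc] at this
  have hcoeff := norm_coeff_zero_mul_le (∑ j ∈ Finset.range b, block γ α a M (2 * j))
    (∑ j ∈ Finset.range b, detector a j) (norm_eval_sum_detector_le a b)
  rw [h.coeff_zero_sum_block_mul_sum_detector heven hodd hu, norm_mul, norm_div, norm_pow,
    norm_pow, Complex.norm_I, one_pow, one_pow, div_one, one_mul, Complex.norm_real] at hcoeff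
  exact hsum.trans ((le_abs_self _).trans hcoeff)

theorem l1Norm_mixedDeriv_extremal_sub_le [NeZero d] (hn : ∑ i, γ i ≤ n) (hδ : 2 ^ n * δ ≤ 1)
    (hu : ∀ j, ratio γ α (a (2 * j)) = u) (hv : ∀ j, ratio γ α (a (2 * j + 1)) ≤ v) :
    l1Norm (mixedDeriv γ (extremal α a M b) - ∑ j ∈ Finset.range b, block γ α a M (2 * j)) ≤
      2 ^ (n + 1) * (2 ^ n * δ) * (b * u) + 2 * (b ^ (n + 2) * v) := by
  have hsplit : mixedDeriv γ (extremal α a M b) - ∑ j ∈ Finset.range b, block γ α a M (2 * j) =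
      ∑ j ∈ Finset.range b, ((mixedDeriv γ (block 0 α a M (2 * j)) - block γ α a M (2 * j)) +
        mixedDeriv γ (block 0 α a M (2 * j + 1))) := by
    rw [extremal, map_sum, sum_range_two_mul, ← Finset.sum_sub_distrib]
    exact Finset.sum_congr rfl fun j _ => add_sub_right_comm _ _ _
  rw [hsplit]
  refine (seminorm_sum_range_le l1Norm b
    (c := 2 ^ (n + 1) * (2 ^ n * δ * u) + 2 * (b ^ (n + 1) * v)) fun j => ?_).trans_eq (by ring)
  refine (map_add_le_add l1Norm _ _).trans (add_le_add ?_ ?_)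
  · have heven_error := h.l1Norm_mixedDeriv_block_sub_block_le α hn (2 * j)
    rwa [heven, hu, Nat.cast_ofNat] at heven_error
  · refine (h.l1Norm_mixedDeriv_block_le α hn hδ (2 * j + 1)).trans ?_
    have := hv j
    rw [hodd]
    gcongr

end Lacunary

end Extremal

/-! ### The parameters of the construction -/

section Parameters

theorem Lacunary.of_growth {a : ℕ → Fin d → ℤ} {M : ℕ → ℕ} {δ : ℝ} (hpos : ∀ k i, 0 < a k i)
    (hM : ∀ k, 2 ≤ M k) (h₀ : 0 ≤ δ) (hδ : δ ≤ 1 / 4)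
    (hgrowth : ∀ k, (2 * M k ^ 2 : ℝ) • freqAbs (a k) ≤ δ • freqAbs (a (k + 1))) :
    Lacunary a M δ := by
  refine ⟨hpos, hM, h₀, hδ, fun k => ?_⟩
  induction k with
  | zero => exact smul_nonneg h₀ (freqAbs_nonneg _)
  | succ k ih =>
    have hδM : δ ≤ M k := by
      have : (2 : ℝ) ≤ M k := by exact_mod_cast hM k
      linarith
    calc (M k : ℝ) • ((M k : ℝ) • freqAbs (a k) + scale a M k)
        ≤ (M k : ℝ) • ((M k : ℝ) • freqAbs (a k) + (M k : ℝ) • freqAbs (a k)) :=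
          smul_le_smul_of_nonneg_left (add_le_add_right
            (ih.trans (smul_le_smul_of_nonneg_right hδM (freqAbs_nonneg _))) _) (Nat.cast_nonneg _)
      _ = (2 * M k ^ 2 : ℝ) • freqAbs (a k) := by module
      _ ≤ δ • freqAbs (a (k + 1)) := hgrowth k

/-- The sequence `x, y, x, y, …`. -/
def alternate (x y k : ℕ) : ℕ := if Even k then x else y

theorem alternate_two_mul (x y j : ℕ) : alternate x y (2 * j) = x := if_pos (even_two_mul j)

theorem alternate_two_mul_add_one (x y j : ℕ) : alternate x y (2 * j + 1) = y :=
  if_neg (Nat.not_even_bit1 j)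

theorem alternate_le {x y z : ℕ} (hx : x ≤ z) (hy : y ≤ z) (k : ℕ) : alternate x y k ≤ z := by
  unfold alternate; split_ifs <;> assumption

theorem le_alternate {x y z : ℕ} (hx : z ≤ x) (hy : z ≤ y) (k : ℕ) : z ≤ alternate x y k := by
  unfold alternate; split_ifs <;> assumption

/-- The frequencies `s ^ (E k Λ + e_k Γ)`, where `e_k` is `1` for even `k` and `e` for odd `k`. The
term `E k Λ` separates the scales and is invisible to the ratios of derivatives of the same
`Λ`-order. -/
def freq (s e E : ℕ) (Λ Γ : Fin d → ℕ) (k : ℕ) (i : Fin d) : ℤ :=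
  s ^ (E * k * Λ i + alternate 1 e k * Γ i)

variable {s e E n p : ℕ} {Λ Γ α γ : Fin d → ℕ}

theorem freqAbs_freq (s e E : ℕ) (Λ Γ : Fin d → ℕ) (k : ℕ) (i : Fin d) :
    freqAbs (freq s e E Λ Γ k) i = (s : ℝ) ^ (E * k * Λ i + alternate 1 e k * Γ i) := by
  simp [freqAbs, freq]

theorem multiPow_freqAbs_freq (s e E : ℕ) (Λ Γ : Fin d → ℕ) (k : ℕ) (γ : Fin d → ℕ) :
    multiPow (freqAbs (freq s e E Λ Γ k)) γ =
      (s : ℝ) ^ (E * k * (γ ⬝ᵥ Λ) + alternate 1 e k * (γ ⬝ᵥ Γ)) := by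
  simp only [multiPow, freqAbs_freq, ← pow_mul, Finset.prod_pow_eq_pow_sum, dotProduct,
    Finset.mul_sum, ← Finset.sum_add_distrib]
  congr 1
  exact Finset.sum_congr rfl fun i _ => by ring

theorem ratio_freq (hs : s ≠ 0) (hΛ : γ ⬝ᵥ Λ = α ⬝ᵥ Λ) (k : ℕ) :
    ratio γ α (freq s e E Λ Γ k) =
      (s : ℝ) ^ (alternate 1 e k * (γ ⬝ᵥ Γ)) / (s : ℝ) ^ (alternate 1 e k * (α ⬝ᵥ Γ)) := by
  rw [ratio, multiPow_freqAbs_freq, multiPow_freqAbs_freq, hΛ, pow_add, pow_add,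
    mul_div_mul_left _ _ (pow_ne_zero _ (Nat.cast_ne_zero.2 hs))]

theorem ratio_freq_two_mul (hs : s ≠ 0) (hΛ : γ ⬝ᵥ Λ = α ⬝ᵥ Λ) (j : ℕ) :
    ratio γ α (freq s e E Λ Γ (2 * j)) = (s : ℝ) ^ (γ ⬝ᵥ Γ) / (s : ℝ) ^ (α ⬝ᵥ Γ) := by
  rw [ratio_freq hs hΛ, alternate_two_mul, one_mul, one_mul]

theorem ratio_freq_two_mul_add_one_le (hs : s ≠ 0) (hΛ : γ ⬝ᵥ Λ = α ⬝ᵥ Λ) (hΓ : γ ⬝ᵥ Γ < α ⬝ᵥ Γ)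
    (j : ℕ) : ratio γ α (freq s e E Λ Γ (2 * j + 1)) ≤ ((s : ℝ) ^ e)⁻¹ := by
  have hs₀ : (0 : ℝ) < s := by exact_mod_cast hs.bot_lt
  rw [ratio_freq hs hΛ, alternate_two_mul_add_one, div_le_iff₀ (by positivity), inv_mul_eq_div,
    le_div_iff₀ (by positivity), ← pow_add, ← Nat.mul_succ]
  exact pow_le_pow_right₀ (by exact_mod_cast hs.bot_lt) (Nat.mul_le_mul_left e hΓ)

theorem smul_freqAbs_freq_le (hs : s ≠ 0) (hΛ : ∀ i, 1 ≤ Λ i) (he : 1 ≤ e) {L : ℝ} (hL : 0 ≤ L)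
    (hE : L * s ^ (e * ∑ i, Γ i) ≤ s ^ E) (k : ℕ) :
    L • freqAbs (freq s e E Λ Γ k) ≤ freqAbs (freq s e E Λ Γ (k + 1)) := fun i => by
  have hs₁ : (1 : ℝ) ≤ s := by exact_mod_cast hs.bot_lt
  have hΓ : alternate 1 e k * Γ i ≤ e * ∑ i, Γ i :=
    Nat.mul_le_mul (alternate_le he le_rfl k)
      (Finset.single_le_sum (fun _ _ => Nat.zero_le _) (Finset.mem_univ i))
  have hgap : E * k * Λ i + E ≤ E * (k + 1) * Λ i := by
    linarith [Nat.le_mul_of_pos_right E (hΛ i)]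
  rw [Pi.smul_apply, smul_eq_mul, freqAbs_freq, freqAbs_freq]
  calc L * (s : ℝ) ^ (E * k * Λ i + alternate 1 e k * Γ i)
      ≤ L * (s : ℝ) ^ (E * k * Λ i + e * ∑ i, Γ i) := by gcongr
    _ = s ^ (E * k * Λ i) * (L * s ^ (e * ∑ i, Γ i)) := by rw [pow_add]; ring
    _ ≤ s ^ (E * k * Λ i) * s ^ E := by gcongr
    _ = (s : ℝ) ^ (E * k * Λ i + E) := (pow_add _ _ _).symm
    _ ≤ _ := pow_le_pow_right₀ hs₁ (hgap.trans (Nat.le_add_right _ _))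

/-- The lacunarity parameter `δ` for derivatives of order at most `n` and Fejér orders at
most `b`. -/
def lacunarity (b n : ℕ) : ℝ := (2 ^ (n + 5) * b ^ (n + 2))⁻¹

theorem two_mul_pow_mul_lacunarity {b : ℕ} (hb : b ≠ 0) (n : ℕ) :
    2 * (b : ℝ) ^ (n + 2) * (2 ^ n * lacunarity b n) = 1 / 16 := by
  rw [lacunarity]
  field_simp
  ring

theorem lacunarity_nonneg (b n : ℕ) : 0 ≤ lacunarity b n := by unfold lacunarity; positivity

theorem two_pow_mul_lacunarity_le {b : ℕ} (hb : 2 ≤ b) (n : ℕ) :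
    2 ^ (n + 1) * (2 ^ n * lacunarity b n) ≤ 1 / 32 := by
  have hb' : (2 : ℝ) ≤ b := by exact_mod_cast hb
  have hpow := mul_le_mul_of_nonneg_right (pow_le_pow_left₀ zero_le_two hb' (n + 2))
    (mul_nonneg (pow_nonneg zero_le_two n) (lacunarity_nonneg b n))
  have hlac := two_mul_pow_mul_lacunarity (by omega : b ≠ 0) n
  rw [pow_succ] at hpow
  linarith

theorem lacunarity_le {b : ℕ} (hb : 2 ≤ b) (n : ℕ) : 2 ^ n * lacunarity b n ≤ 1 / 32 :=
  (le_mul_of_one_le_left (mul_nonneg (by positivity) (lacunarity_nonneg b n))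
    (one_le_pow₀ one_le_two)).trans (two_pow_mul_lacunarity_le hb n)

/-- The exponent `e` in `freq` for Fejér orders `s ^ p` and derivatives of order at most `n`. -/
def oddExponent (p n : ℕ) : ℕ := 6 + p * (n + 2)

/-- The exponent `E` in `freq` for Fejér orders `s ^ p` and derivatives of order at most `n`. -/
def gapExponent (p n : ℕ) (Γ : Fin d → ℕ) : ℕ :=
  (n + 6) + p * (n + 4) + oddExponent p n * ∑ i, Γ i

theorem two_mul_pow_div_pow_oddExponent_le (hs : 2 ≤ s) (p n : ℕ) :
    2 * (((s ^ p : ℕ) : ℝ) ^ (n + 2) * ((s : ℝ) ^ oddExponent p n)⁻¹) ≤ 1 / 32 := by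
  have hs' : (2 : ℝ) ≤ s := by exact_mod_cast hs
  have hpow : (2 : ℝ) ^ 6 ≤ s ^ 6 := pow_le_pow_left₀ zero_le_two hs' 6
  rw [oddExponent, Nat.cast_pow, ← pow_mul, pow_add, mul_inv_rev,
    mul_inv_cancel_left₀ (by positivity)]
  calc 2 * ((s : ℝ) ^ 6)⁻¹ ≤ 2 * (2 ^ 6)⁻¹ := by gcongr
    _ = 1 / 32 := by norm_num

theorem lacunary_freq (hs : 2 ≤ s) (hp : p ≠ 0) (hΛ : ∀ i, 1 ≤ Λ i) (Γ : Fin d → ℕ) (n : ℕ) :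
    Lacunary (freq s (oddExponent p n) (gapExponent p n Γ) Λ Γ) (alternate 2 (s ^ p))
      (lacunarity (s ^ p) n) := by
  have hs₀ : s ≠ 0 := by omega
  have hb : 2 ≤ s ^ p := hs.trans (Nat.le_self_pow hp s)
  have hδ := lacunarity_nonneg (s ^ p) n
  refine .of_growth (fun k i => pow_pos (by exact_mod_cast hs₀.bot_lt) _)
    (le_alternate le_rfl hb) hδ ?_ fun k => ?_
  · have : lacunarity (s ^ p) n ≤ 2 ^ n * lacunarity (s ^ p) n :=
      le_mul_of_one_le_left hδ (one_le_pow₀ one_le_two)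
    linarith [lacunarity_le hb n]
  have hgrowth : ((2 : ℝ) ^ (n + 6) * ((s ^ p : ℕ) : ℝ) ^ (n + 4)) *
      s ^ (oddExponent p n * ∑ i, Γ i) ≤ s ^ gapExponent p n Γ := by
    have hs' : (2 : ℝ) ≤ s := by exact_mod_cast hs
    rw [gapExponent, pow_add (s : ℝ) (_ + _), pow_add (s : ℝ) (n + 6), Nat.cast_pow, ← pow_mul]
    gcongr
  refine le_trans ?_ (smul_le_smul_of_nonneg_left
    (smul_freqAbs_freq_le hs₀ hΛ (by unfold oddExponent; omega) (by positivity) hgrowth k) hδ)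
  rw [smul_smul]
  refine smul_le_smul_of_nonneg_right ?_ (freqAbs_nonneg _)
  calc (2 * (alternate 2 (s ^ p) k : ℝ) ^ 2) ≤ 2 * ((s ^ p : ℕ) : ℝ) ^ 2 := by
        have : (alternate 2 (s ^ p) k : ℝ) ≤ (s ^ p : ℕ) := by
          exact_mod_cast alternate_le hb le_rfl k
        gcongr
    _ = lacunarity (s ^ p) n * (2 ^ (n + 6) * ((s ^ p : ℕ) : ℝ) ^ (n + 4)) := by
        have : ((s ^ p : ℕ) : ℝ) ≠ 0 := by exact_mod_cast pow_ne_zero p hs₀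
        rw [lacunarity]
        field_simp
        ring

end Parameters

section Witness

variable {s n p r : ℕ} {Λ Γ α γ : Fin d → ℕ}

/-- The polynomial with large `D^β` and bounded `D^α`, `D^γ`: the extremal polynomial for the
frequencies `freq` and the Fejér orders `2, s ^ p, 2, s ^ p, …`. -/
def witness (s p n : ℕ) (Λ Γ α : Fin d → ℕ) : TrigPoly d :=
  extremal α (freq s (oddExponent p n) (gapExponent p n Γ) Λ Γ) (alternate 2 (s ^ p)) (s ^ p)

theorem witness_mem_degLE {N : ℕ} (hs : 2 ≤ s) (hp : p ≠ 0) (hΛ : ∀ i, 1 ≤ Λ i) (α : Fin d → ℕ)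
    (hN : s ^ ((2 * gapExponent p n Γ * ∑ i, Λ i + ∑ i, Γ i + 1) * s ^ p) ≤ N) :
    witness s p n Λ Γ α ∈ degLE fun _ => (N : ℝ) := by
  have h := lacunary_freq hs hp hΛ Γ n
  refine degLE_mono (fun i => ?_) (h.extremal_mem_degLE α (s ^ p))
  have hΛi : Λ i ≤ ∑ i, Λ i := Finset.single_le_sum (fun _ _ => Nat.zero_le _) (Finset.mem_univ i)
  have hΓi : Γ i ≤ ∑ i, Γ i := Finset.single_le_sum (fun _ _ => Nat.zero_le _) (Finset.mem_univ i)
  have hexponent : gapExponent p n Γ * (2 * s ^ p) * Λ i + Γ i ≤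
      (2 * gapExponent p n Γ * ∑ i, Λ i + ∑ i, Γ i + 1) * s ^ p := by
    have hb : 1 ≤ s ^ p := Nat.one_le_pow _ _ (by omega)
    calc gapExponent p n Γ * (2 * s ^ p) * Λ i + Γ i
        ≤ gapExponent p n Γ * (2 * s ^ p) * (∑ i, Λ i) + (∑ i, Γ i) * s ^ p :=
          Nat.add_le_add (Nat.mul_le_mul_left _ hΛi) (hΓi.trans (Nat.le_mul_of_pos_right _ hb))
      _ ≤ _ := by linarith
  have hfreq : freqAbs (freq s (oddExponent p n) (gapExponent p n Γ) Λ Γ (2 * s ^ p)) i ≤ N := by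
    rw [freqAbs_freq, alternate_two_mul, one_mul]
    exact_mod_cast (Nat.pow_le_pow_right (by omega) hexponent).trans hN
  exact (h.scale_le _ i).trans ((mul_le_of_le_one_left (freqAbs_nonneg _ i)
    (h.le_quarter.trans (by norm_num))).trans hfreq)

theorem l1Norm_mixedDeriv_self_witness_le [NeZero d] (hs : 2 ≤ s) (hp : p ≠ 0)
    (hΛ : ∀ i, 1 ≤ Λ i) (hn : ∑ i, α i ≤ n) :
    l1Norm (mixedDeriv α (witness s p n Λ Γ α)) ≤ 3 := by
  have hb : 2 ≤ s ^ p := hs.trans (Nat.le_self_pow hp s)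
  refine (lacunary_freq hs hp hΛ Γ n).l1Norm_mixedDeriv_self_extremal_le
    (alternate_le hb le_rfl) hn ?_
  rw [two_mul_pow_mul_lacunarity (by omega)]
  norm_num

/-- The leading part of `D^γ (witness s p n Λ Γ α)`. -/
def leadingPart (s p n : ℕ) (Λ Γ α γ : Fin d → ℕ) : TrigPoly d :=
  ∑ j ∈ Finset.range (s ^ p), block γ α
    (freq s (oddExponent p n) (gapExponent p n Γ) Λ Γ) (alternate 2 (s ^ p)) (2 * j)

theorem pow_mul_pow_div_pow (hs : s ≠ 0) {x y : ℕ} (h : x + p = y + r) :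
    ((s ^ p : ℕ) : ℝ) * ((s : ℝ) ^ x / (s : ℝ) ^ y) = s ^ r := by
  have hs' : (s : ℝ) ≠ 0 := Nat.cast_ne_zero.2 hs
  rw [Nat.cast_pow, ← mul_div_assoc, ← pow_add, div_eq_iff (pow_ne_zero _ hs'), ← pow_add]
  congr 1
  omega

theorem l1Norm_mixedDeriv_witness_sub_leadingPart_le [NeZero d] (hs : 2 ≤ s) (hp : p ≠ 0)
    (hΛpos : ∀ i, 1 ≤ Λ i) (hΛ : γ ⬝ᵥ Λ = α ⬝ᵥ Λ) (hΓ : γ ⬝ᵥ Γ < α ⬝ᵥ Γ) (hn : ∑ i, γ i ≤ n) :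
    l1Norm (mixedDeriv γ (witness s p n Λ Γ α) - leadingPart s p n Λ Γ α γ) ≤
      ((s ^ p : ℕ) * ((s : ℝ) ^ (γ ⬝ᵥ Γ) / (s : ℝ) ^ (α ⬝ᵥ Γ)) + 1) / 32 := by
  have hs₀ : s ≠ 0 := by omega
  have hb : 2 ≤ s ^ p := hs.trans (Nat.le_self_pow hp s)
  have herror := (lacunary_freq hs hp hΛpos Γ n).l1Norm_mixedDeriv_extremal_sub_le
    (alternate_two_mul _ _) (alternate_two_mul_add_one _ _) hn
    ((lacunarity_le hb n).trans (by norm_num)) (ratio_freq_two_mul hs₀ hΛ)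
    (ratio_freq_two_mul_add_one_le hs₀ hΛ hΓ)
  have hδ := mul_le_mul_of_nonneg_right (two_pow_mul_lacunarity_le hb n)
    (by positivity : 0 ≤ ((s ^ p : ℕ) : ℝ) * ((s : ℝ) ^ (γ ⬝ᵥ Γ) / (s : ℝ) ^ (α ⬝ᵥ Γ)))
  have hv := two_mul_pow_div_pow_oddExponent_le hs p n
  refine herror.trans ?_
  linarith

theorem l1Norm_mixedDeriv_witness_le [NeZero d] (hs : 2 ≤ s) (hp : p ≠ 0)
    (hΛpos : ∀ i, 1 ≤ Λ i) (hΛ : γ ⬝ᵥ Λ = α ⬝ᵥ Λ) (hΓ : γ ⬝ᵥ Γ + p ≤ α ⬝ᵥ Γ)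
    (hn : ∑ i, γ i ≤ n) :
    l1Norm (mixedDeriv γ (witness s p n Λ Γ α)) ≤ 2 ^ (n + 2) := by
  have hs₀ : s ≠ 0 := by omega
  have hlt : γ ⬝ᵥ Γ < α ⬝ᵥ Γ := by omega
  have hsmall : ((s ^ p : ℕ) : ℝ) * ((s : ℝ) ^ (γ ⬝ᵥ Γ) / (s : ℝ) ^ (α ⬝ᵥ Γ)) ≤ 1 := by
    have hs₁ : (1 : ℝ) ≤ s := by exact_mod_cast hs₀.bot_lt
    rw [Nat.cast_pow, ← mul_div_assoc, ← pow_add, div_le_one (by positivity), add_comm]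
    exact pow_le_pow_right₀ hs₁ hΓ
  have herror := l1Norm_mixedDeriv_witness_sub_leadingPart_le hs hp hΛpos hΛ hlt hn
  have hleading : l1Norm (leadingPart s p n Λ Γ α γ) ≤ _ :=
    (lacunary_freq hs hp hΛpos Γ n).l1Norm_sum_block_le (alternate_two_mul _ _) hn
      (ratio_freq_two_mul hs₀ hΛ)
  have htriangle := map_add_le_add l1Norm
    (mixedDeriv γ (witness s p n Λ Γ α) - leadingPart s p n Λ Γ α γ) (leadingPart s p n Λ Γ α γ)
  rw [sub_add_cancel] at htriangle
  have hpow : (1 : ℝ) ≤ 2 ^ (n + 1) := one_le_pow₀ one_le_two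
  have := mul_le_mul_of_nonneg_left hsmall (zero_le_one.trans hpow)
  rw [pow_succ (2 : ℝ) (n + 1)]
  linarith

theorem le_l1Norm_mixedDeriv_witness [NeZero d] (hs : 2 ≤ s) (hp : p ≠ 0)
    (hΛpos : ∀ i, 1 ≤ Λ i) (hΛ : γ ⬝ᵥ Λ = α ⬝ᵥ Λ) (hΓ : γ ⬝ᵥ Γ < α ⬝ᵥ Γ)
    (hr : γ ⬝ᵥ Γ + p = α ⬝ᵥ Γ + r) (hn : ∑ i, γ i ≤ n) :
    (s : ℝ) ^ r / 16 ≤ l1Norm (mixedDeriv γ (witness s p n Λ Γ α)) := by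
  have hs₀ : s ≠ 0 := by omega
  have hpow : (1 : ℝ) ≤ s ^ r := one_le_pow₀ (by exact_mod_cast hs₀.bot_lt)
  have hleading : _ ≤ l1Norm (leadingPart s p n Λ Γ α γ) :=
    (lacunary_freq hs hp hΛpos Γ n).le_l1Norm_sum_block (alternate_two_mul _ _)
      (alternate_two_mul_add_one _ _) (ratio_freq_two_mul hs₀ hΛ)
  have herror := l1Norm_mixedDeriv_witness_sub_leadingPart_le hs hp hΛpos hΛ hΓ hn
  rw [pow_mul_pow_div_pow hs₀ hr] at hleading herror
  have htriangle := map_sub_le_add l1Norm (mixedDeriv γ (witness s p n Λ Γ α))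
    (mixedDeriv γ (witness s p n Λ Γ α) - leadingPart s p n Λ Γ α γ)
  rw [sub_sub_cancel] at htriangle
  linarith

end Witness

/-! ### Lower bounds for the best constant -/

section BestConst

theorem isTrigPolyLE_eval {N : ℕ} {f : TrigPoly d} (hf : f ∈ degLE fun _ => (N : ℝ)) :
    IsTrigPolyLE N (eval f) := by
  refine ⟨f.coeff, fun x => ?_⟩
  rw [eval_apply]
  refine Finset.sum_subset (fun q hq => Fintype.mem_piFinset.2 fun i => ?_) fun q _ hq => ?_
  · have h : |(q i : ℝ)| ≤ N := AddMonoidAlgebra.mem_supported.1 hf hq i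
    rw [abs_le] at h
    exact Finset.mem_Icc.2 ⟨by exact_mod_cast h.1, by exact_mod_cast h.2⟩
  · rw [Finsupp.notMem_support_iff.1 hq, zero_mul]

variable {m N : ℕ} {α : ℕ → Fin d → ℕ} {β : Fin d → ℕ}

theorem ofReal_div_le_bestConst {f : TrigPoly d} (hf : f ∈ degLE fun _ => (N : ℝ)) {A B : ℝ}
    (hA : 0 < A) (hle : ∑ j ∈ Finset.Icc 1 m, l1Norm (mixedDeriv (α j) f) ≤ A)
    (hB : B ≤ l1Norm (mixedDeriv β f)) : ENNReal.ofReal (B / A) ≤ bestConst m α β N := by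
  refine le_iInf₂ fun K hK => ?_
  have h := hK _ (isTrigPolyLE_eval hf)
  simp only [multiDeriv_eval, ← l1Norm_apply] at h
  rw [ENNReal.ofReal_le_coe, div_le_iff₀ hA]
  exact hB.trans (h.trans (mul_le_mul_of_nonneg_left hle K.2))

theorem ofReal_inv_le_bestConst (hm : m ≠ 0) (hN : 1 ≤ N) (α : ℕ → Fin d → ℕ) (β : Fin d → ℕ) :
    ENNReal.ofReal (1 / m) ≤ bestConst m α β N := by
  have hD : ∀ γ : Fin d → ℕ, l1Norm (mixedDeriv γ (character fun _ => 1)) = 1 := fun γ => by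
    rw [mixedDeriv, multiplier_character, map_smul_eq_mul, norm_symbol, l1Norm_character]
    simp [multiPow, freqAbs]
  have hmem : character (fun _ => 1) ∈ degLE fun _ : Fin d => (N : ℝ) :=
    character_mem_supported fun i => by simpa [freqAbs] using hN
  exact ofReal_div_le_bestConst hmem (by positivity) (by simp [hD]) (hD β).ge

theorem exists_le_bestConst [NeZero d] {Λ Γ : Fin d → ℕ} (hm : 2 ≤ m) (hΛpos : ∀ i, 1 ≤ Λ i)
    (hΛ : ∀ j ∈ Finset.Icc 1 m, α j ⬝ᵥ Λ = β ⬝ᵥ Λ) (hβ : β ⬝ᵥ Γ < α 1 ⬝ᵥ Γ) {p r : ℕ}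
    (hp : p ≠ 0) (hα : ∀ j ∈ Finset.Icc 2 m, α j ⬝ᵥ Γ + p ≤ α 1 ⬝ᵥ Γ)
    (hr : β ⬝ᵥ Γ + p = α 1 ⬝ᵥ Γ + r) :
    ∃ c : ℝ, 0 < c ∧ ∃ C : ℕ, 1 ≤ C ∧ ∀ s N : ℕ, 2 ≤ s → s ^ (C * s ^ p) ≤ N →
      ENNReal.ofReal (c * s ^ r) ≤ bestConst m α β N := by
  let n := ∑ i, β i + ∑ j ∈ Finset.Icc 1 m, ∑ i, α j i
  have hnα : ∀ j ∈ Finset.Icc 1 m, ∑ i, α j i ≤ n := fun j hj =>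
    (Finset.single_le_sum (f := fun j => ∑ i, α j i) (fun _ _ => Nat.zero_le _) hj).trans
      (Nat.le_add_left _ _)
  have h1 : 1 ∈ Finset.Icc 1 m := Finset.mem_Icc.2 ⟨le_rfl, by omega⟩
  refine ⟨(16 * (m * 2 ^ (n + 2)))⁻¹, by positivity,
    2 * gapExponent p n Γ * ∑ i, Λ i + ∑ i, Γ i + 1, by omega, fun s N hs hN => ?_⟩
  have hupper : ∀ j ∈ Finset.Icc 1 m,
      l1Norm (mixedDeriv (α j) (witness s p n Λ Γ (α 1))) ≤ 2 ^ (n + 2) := fun j hj => by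
    rcases eq_or_ne j 1 with rfl | hj1
    · have hpow : (2 : ℝ) ^ 2 ≤ 2 ^ (n + 2) := pow_le_pow_right₀ one_le_two (by omega)
      linarith [l1Norm_mixedDeriv_self_witness_le (Γ := Γ) hs hp hΛpos (hnα 1 h1)]
    · have hj2 : j ∈ Finset.Icc 2 m := by
        rw [Finset.mem_Icc] at hj ⊢
        omega
      exact l1Norm_mixedDeriv_witness_le hs hp hΛpos ((hΛ j hj).trans (hΛ 1 h1).symm)
        (hα j hj2) (hnα j hj)
  have hlower := le_l1Norm_mixedDeriv_witness hs hp hΛpos (hΛ 1 h1).symm hβ hr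
    (Nat.le_add_right _ _ : ∑ i, β i ≤ n)
  have hsum : ∑ j ∈ Finset.Icc 1 m, l1Norm (mixedDeriv (α j) (witness s p n Λ Γ (α 1))) ≤
      m * 2 ^ (n + 2) := by
    simpa using Finset.sum_le_card_nsmul _ _ _ hupper
  convert! ofReal_div_le_bestConst (witness_mem_degLE hs hp hΛpos (α 1) hN) (by positivity)
    hsum hlower using 2
  field_simp

end BestConst

end

end TrigPoly

section Growth

variable {C p r : ℕ} {φ : ℝ}

theorem exists_pow_mul_pow_le_lt {N : ℕ} (hC : C ≠ 0) (hN : 2 ^ (C * 2 ^ p) ≤ N) :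
    ∃ s, 2 ≤ s ∧ s ^ (C * s ^ p) ≤ N ∧ N < (s + 1) ^ (C * (s + 1) ^ p) := by
  let P : ℕ → Prop := fun s => s ^ (C * s ^ p) ≤ N
  have hN2 : 2 ≤ N := (Nat.le_self_pow (by positivity) 2).trans hN
  refine ⟨Nat.findGreatest P N, Nat.le_findGreatest hN2 hN,
    Nat.findGreatest_spec (P := P) hN2 hN, ?_⟩
  by_contra! h
  have hle : Nat.findGreatest P N + 1 ≤ N := (Nat.le_self_pow (by positivity) _).trans h
  exact Nat.findGreatest_is_greatest (P := P) (Nat.lt_succ_self _) hle h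

theorem exists_log_rpow_le (hC : C ≠ 0) (hφ₀ : 0 < φ) (hφ : φ * p < r) :
    ∃ X : ℝ, 0 < X ∧ ∀ s N : ℕ, 1 ≤ s → 1 ≤ N → N < (s + 1) ^ (C * (s + 1) ^ p) →
      Real.log N ^ φ ≤ X * s ^ r := by
  let ε : ℝ := r / φ - p
  have hε : 0 < ε := sub_pos.2 ((lt_div_iff₀' hφ₀).2 hφ)
  refine ⟨(C / ε) ^ φ * 2 ^ r, by positivity, fun s N hs hN hNs => ?_⟩
  have hlog : Real.log N ≤ C / ε * ((s : ℝ) + 1) ^ ((r : ℝ) / φ) :=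
    calc Real.log N ≤ Real.log (((s : ℝ) + 1) ^ (C * (s + 1) ^ p)) :=
          Real.log_le_log (by exact_mod_cast hN) (by exact_mod_cast hNs.le)
      _ = C * ((s : ℝ) + 1) ^ p * Real.log (s + 1) := by simp [Real.log_pow]
      _ ≤ C * ((s : ℝ) + 1) ^ p * (((s : ℝ) + 1) ^ ε / ε) := by
          gcongr
          exact Real.log_le_rpow_div (by positivity) hε
      _ = C / ε * ((s : ℝ) + 1) ^ ((p : ℝ) + ε) := by
          rw [Real.rpow_add (by positivity), Real.rpow_natCast]
          ring
      _ = C / ε * ((s : ℝ) + 1) ^ ((r : ℝ) / φ) := by rw [add_sub_cancel]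
  have hs₁ : (1 : ℝ) ≤ s := by exact_mod_cast hs
  calc Real.log N ^ φ ≤ (C / ε * ((s : ℝ) + 1) ^ ((r : ℝ) / φ)) ^ φ :=
        Real.rpow_le_rpow (Real.log_natCast_nonneg N) hlog hφ₀.le
    _ = (C / ε) ^ φ * ((s : ℝ) + 1) ^ r := by
        rw [Real.mul_rpow (by positivity) (by positivity), ← Real.rpow_mul (by positivity),
          div_mul_cancel₀ _ hφ₀.ne', Real.rpow_natCast]
    _ ≤ (C / ε) ^ φ * (2 * s) ^ r := by
        gcongr
        linarith
    _ = (C / ε) ^ φ * 2 ^ r * s ^ r := by rw [mul_pow, mul_assoc]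

theorem exists_mul_log_rpow_lt {K : ℕ → ℝ≥0∞} {b c : ℝ} (hC : C ≠ 0) (hφ₀ : 0 < φ)
    (hφ : φ * p < r) (hb : 0 < b) (hc : 0 < c) (hK : ∀ N, 1 ≤ N → ENNReal.ofReal b ≤ K N)
    (hK' : ∀ s N : ℕ, 2 ≤ s → s ^ (C * s ^ p) ≤ N → ENNReal.ofReal (c * s ^ r) ≤ K N) :
    ∃ A : ℝ, 0 < A ∧ ∀ N : ℕ, 1 ≤ N → ENNReal.ofReal (A * Real.log N ^ φ) < K N := by
  obtain ⟨X, hX₀, hX⟩ := exists_log_rpow_le hC hφ₀ hφ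
  let Y : ℝ := Real.log (2 ^ (C * 2 ^ p) : ℕ) ^ φ
  have hY₀ : 0 ≤ Y := Real.rpow_nonneg (Real.log_natCast_nonneg _) _
  let Z : ℝ := X / c + Y / b
  have hZ : 0 < Z := by positivity
  refine ⟨(2 * Z)⁻¹, by positivity, fun N hN => ?_⟩
  obtain ⟨t, ht, htK, htlog⟩ :
      ∃ t : ℝ, 0 < t ∧ ENNReal.ofReal t ≤ K N ∧ Real.log N ^ φ ≤ Z * t := by
    rcases le_or_gt (2 ^ (C * 2 ^ p)) N with hlarge | hsmall
    · obtain ⟨s, hs, hsN, hNs⟩ := exists_pow_mul_pow_le_lt hC hlarge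
      have hs₀ : (0 : ℝ) < s := by exact_mod_cast zero_lt_two.trans_le hs
      refine ⟨c * s ^ r, by positivity, hK' s N hs hsN, ?_⟩
      calc Real.log N ^ φ ≤ X * s ^ r := hX s N (by omega) hN hNs
        _ = X / c * (c * s ^ r) := by field_simp
        _ ≤ Z * (c * s ^ r) := by
            gcongr
            exact le_add_of_nonneg_right (by positivity)
    · refine ⟨b, hb, hK N hN, ?_⟩
      have hlog : Real.log N ≤ Real.log (2 ^ (C * 2 ^ p) : ℕ) :=
        Real.log_le_log (by exact_mod_cast hN) (by exact_mod_cast hsmall.le)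
      calc Real.log N ^ φ ≤ Y := Real.rpow_le_rpow (Real.log_natCast_nonneg _) hlog hφ₀.le
        _ = Y / b * b := by field_simp
        _ ≤ Z * b := by
            gcongr
            exact le_add_of_nonneg_left (by positivity)
  refine lt_of_lt_of_le ((ENNReal.ofReal_lt_ofReal_iff ht).2 ?_) htK
  calc (2 * Z)⁻¹ * Real.log N ^ φ ≤ (2 * Z)⁻¹ * (Z * t) := by gcongr
    _ = t / 2 := by field_simp
    _ < t := half_lt_self ht

end Growth

theorem sub_div_sub_lt_one {a b c : ℕ} (hab : a < b) (hbc : b < c) :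
    ((c : ℝ) - b) / ((c : ℝ) - a) < 1 :=
  (div_lt_one (sub_pos.2 (by exact_mod_cast hab.trans hbc))).2
    (sub_lt_sub_left (by exact_mod_cast hab) _)

theorem theorem1_general (d m : ℕ) (hm : 2 ≤ m) (α : ℕ → Fin d → ℕ) (β : Fin d → ℕ)
    (Λ Γ : Fin d → ℕ) (hΛpos : ∀ i, 1 ≤ Λ i)
    (hΛ : ∀ j ∈ Finset.Icc 1 m, α j ⬝ᵥ Λ = β ⬝ᵥ Λ)
    (hα₁ : β ⬝ᵥ Γ < α 1 ⬝ᵥ Γ) (hα₂ : α 2 ⬝ᵥ Γ < β ⬝ᵥ Γ)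
    (hα : ∀ j ∈ Finset.Icc 2 m, α j ⬝ᵥ Γ ≤ α 2 ⬝ᵥ Γ) (φ : ℝ) (hφ₀ : 0 < φ)
    (hφ : φ < 1 - (((α 1 ⬝ᵥ Γ : ℕ) : ℝ) - ((β ⬝ᵥ Γ : ℕ) : ℝ)) /
      (((α 1 ⬝ᵥ Γ : ℕ) : ℝ) - ((α 2 ⬝ᵥ Γ : ℕ) : ℝ))) :
    ∃ C : ℝ, 0 < C ∧ ∀ N : ℕ, 1 ≤ N →
      ENNReal.ofReal (C * Real.log N ^ φ) < bestConst m α β N := by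
  have : NeZero d := ⟨by rintro rfl; simp [dotProduct] at hα₁⟩
  have hm₀ : m ≠ 0 := by omega
  obtain ⟨p, hp⟩ := Nat.exists_eq_add_of_le (hα₂.trans hα₁).le
  obtain ⟨r, hr⟩ := Nat.exists_eq_add_of_le hα₂.le
  obtain ⟨c, hc, C, hC, hlower⟩ := TrigPoly.exists_le_bestConst (p := p) (r := r) hm hΛpos hΛ hα₁
    (by omega) (fun j hj => hp ▸ Nat.add_le_add_right (hα j hj) p) (by omega)
  have hp₀ : (0 : ℝ) < p := by exact_mod_cast (by omega : 0 < p)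
  have hφpr : φ * p < r := by
    rw [hp, hr] at hφ
    push_cast at hφ
    rw [add_sub_add_left_eq_sub, add_sub_cancel_left, one_sub_div hp₀.ne', sub_sub_cancel] at hφ
    exact (lt_div_iff₀ hp₀).1 hφ
  exact exists_mul_log_rpow_lt (by omega) hφ₀ hφpr (one_div_pos.2 (by positivity)) hc
    (fun N hN => TrigPoly.ofReal_inv_le_bestConst hm₀ hN α β) hlower

theorem theorem1 (d m : ℕ) (hm : 2 ≤ m) (α : ℕ → Fin d → ℕ) (β : Fin d → ℕ)
    (Λ Γ : Fin d → ℕ) (hΛpos : ∀ i, 1 ≤ Λ i) (hΓpos : ∀ i, 1 ≤ Γ i)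
    (hΛ : ∀ j ∈ Finset.Icc 1 m, α j ⬝ᵥ Λ = β ⬝ᵥ Λ)
    (hα₁ : β ⬝ᵥ Γ < α 1 ⬝ᵥ Γ) (hα₂ : α 2 ⬝ᵥ Γ < β ⬝ᵥ Γ)
    (hα : ∀ j, 2 ≤ j → j + 1 ≤ m → α (j + 1) ⬝ᵥ Γ ≤ α j ⬝ᵥ Γ)
    (φ : ℝ)
    (hφ : φ = 1 / 2 * (1 - (((α 1 ⬝ᵥ Γ : ℕ) : ℝ) - ((β ⬝ᵥ Γ : ℕ) : ℝ)) /
      (((α 1 ⬝ᵥ Γ : ℕ) : ℝ) - ((α 2 ⬝ᵥ Γ : ℕ) : ℝ)))) :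
    ∃ C : ℝ, 0 < C ∧ ∀ N : ℕ, 1 ≤ N →
      ENNReal.ofReal (C * Real.log N ^ φ) < bestConst m α β N := by
  have hanti : AntitoneOn (fun j => α j ⬝ᵥ Γ) (Set.Icc 2 m) :=
    antitoneOn_of_succ_le Set.ordConnected_Icc fun j _ hj hj' => hα j hj.1 hj'.2
  have hratio := sub_div_sub_lt_one hα₂ hα₁
  exact theorem1_general d m hm α β Λ Γ hΛpos hΛ hα₁ hα₂
    (fun j hj => hanti ⟨le_rfl, hm⟩ (Finset.mem_Icc.1 hj) (Finset.mem_Icc.1 hj).1) φ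
    (by linarith) (by linarith)
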